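/- Let $\ell_2$ be the real Hilbert space of square-summable sequences. A *name* of a point $x\in\ell_2$ is a sequence $(a_n)_{n\in\mathbb{N}}$ of finite sequences of rational numbers (identified with the vectors $(r_0,\dots,r_m,0,0,\dots)\in\ell_2$ and coded by natural numbers in the usual way) such that $\lVert a_n-a_m\rVert<2^{-n}$ for all $m>n$ and $a_n\to x$ in norm. A sequence $(x_i)_{i\in\mathbb{N}}$ in $\ell_2$ is *computable* if there is a computable double sequence $(a_{i,n})_{i,n}$ such that $(a_{i,n})_n$ is a name of $x_i$ for every $i$; a Turing degree $d$ *computes* a point $x$ if some name of $x$ is computable in $d$. A point $x$ is a *weak cluster point* of $(x_i)_i$ if there is a subsequence $(x_{i_k})_k$ with $\lim_{k\to\infty}\langle y,x_{i_k}\rangle=\langle y,x\rangle$ for all $y\in\ell_2$. Let $0''$ be the degree of the second Turing jump of $\emptyset$, where the jump of $A\subseteq\mathbb{N}$ is $A'=\{e \mid \{e\}^A(e)\text{ halts}\}$. For every Turing degree $d$ the following are equivalent: 1. $d\ge_T 0''$; 2. for every computable sequence $(x_i)_i$ in $\ell_2$ that is bounded in norm, $d$ computes a weak cluster point of $(x_i)_i$.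 -/

import Mathlib

open Filter Topology

/-! ### Oracle machines and the Turing jump -/

/-- Programs for partial recursive functions `ℕ →. ℕ` with an oracle: the programs of
`Nat.Partrec.Code` together with one instruction that queries the oracle. -/
inductive OracleCode : Type
  | zero : OracleCode
  | succ : OracleCode
  | left : OracleCode
  | right : OracleCode
  | oracle : OracleCode
  | pair : OracleCode → OracleCode → OracleCode
  | comp : OracleCode → OracleCode → OracleCode
  | prec : OracleCode → OracleCode → OracleCode
  | rfind' : OracleCode → OracleCode

namespace OracleCode

/-- The partial function computed by a program with oracle `g`. -/
def eval (g : ℕ → ℕ) : OracleCode → ℕ →. ℕ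
  | zero => pure 0
  | succ => fun n => Part.some (n + 1)
  | left => fun n => Part.some n.unpair.1
  | right => fun n => Part.some n.unpair.2
  | oracle => fun n => Part.some (g n)
  | pair cf cg => fun n => Nat.pair <$> eval g cf n <*> eval g cg n
  | comp cf cg => fun n => eval g cg n >>= eval g cf
  | prec cf cg =>
    Nat.unpaired fun a n =>
      n.rec (eval g cf a) fun y IH => do
        let i ← IH
        eval g cg (Nat.pair a (Nat.pair y i))
  | rfind' cf =>
    Nat.unpaired fun a m =>
      (Nat.rfind fun n => (fun k => k = 0) <$> eval g cf (Nat.pair a (n + m))).map (· + m)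

/-- The Gödel numbering of programs: `ofNat e` is the program with index `e`, and every program
has exactly one index. -/
def ofNat : ℕ → OracleCode
  | 0 => zero
  | 1 => succ
  | 2 => left
  | 3 => right
  | 4 => oracle
  | n + 5 =>
    let m := n.div2.div2
    have hm : m < n + 5 := by
      simp only [m, Nat.div2_val]
      exact lt_of_le_of_lt (le_trans (Nat.div_le_self _ _) (Nat.div_le_self _ _))
        (Nat.lt_add_of_pos_right (by decide))
    have _m1 : m.unpair.1 < n + 5 := lt_of_le_of_lt m.unpair_left_le hm
    have _m2 : m.unpair.2 < n + 5 := lt_of_le_of_lt m.unpair_right_le hm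
    match n.bodd, n.div2.bodd with
    | false, false => pair (ofNat m.unpair.1) (ofNat m.unpair.2)
    | false, true  => comp (ofNat m.unpair.1) (ofNat m.unpair.2)
    | true,  false => prec (ofNat m.unpair.1) (ofNat m.unpair.2)
    | true,  true  => rfind' (ofNat m)
termination_by e => e
decreasing_by all_goals first | exact _m1 | exact _m2 | exact hm

end OracleCode

/-- The characteristic function of a set of natural numbers. -/
noncomputable def charFun (A : Set ℕ) : ℕ → ℕ := A.indicator 1

/-- The Turing jump `A' = {e | {e}^A(e) halts}`. -/
def turingJump (A : Set ℕ) : Set ℕ :=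
  {e | ((OracleCode.ofNat e).eval (charFun A) e).Dom}

/-- The Turing degree of a (total) function on the natural numbers. Mathlib's `TuringDegree`
consists of the degrees of all partial functions; those of sets and total functions are among
them. -/
def degreeOf (f : ℕ → ℕ) : TuringDegree :=
  toAntisymmetrization TuringReducible (fun n => Part.some (f n))

/-- The degree `0''`. -/
noncomputable def zeroDoubleJump : TuringDegree :=
  degreeOf (charFun (turingJump (turingJump ∅)))

/-! ### Computability in `ℓ₂` -/

/-- The real Hilbert space `ℓ₂`. -/
abbrev Ell2 : Type := lp (fun _ : ℕ => ℝ) 2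

theorem memLp_finiteSeq (r : List ℚ) :
    Memℓp (E := fun _ : ℕ => ℝ) (fun j => ((r.getD j 0 : ℚ) : ℝ)) 2 := by
  refine (memℓp_zero ?_).of_exponent_ge zero_le
  refine (Set.finite_lt_nat r.length).subset fun j hj => ?_
  by_contra h
  have h0 : r.getD j 0 = 0 := List.getD_eq_default _ _ (not_lt.mp h)
  exact hj (by rw [h0, Rat.cast_zero])

/-- The vector `(r₀, …, rₘ, 0, 0, …)` of `ℓ₂` given by a finite sequence of rationals. These
vectors are the countable dense `ℚ`-vector space whose completion is `ℓ₂`. -/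
def finiteSeqVec (r : List ℚ) : Ell2 := ⟨fun j => ((r.getD j 0 : ℚ) : ℝ), memLp_finiteSeq r⟩

/-- The code of a finite sequence of rationals, each rational being coded by its numerator and
denominator in lowest terms. -/
def finiteSeqCode (r : List ℚ) : ℕ :=
  Encodable.encode (r.map fun q => (q.num, q.den))

/-- `a` is a name of `x`: a sequence of finite rational sequences with
`‖a n - a m‖ < 2⁻ⁿ` for all `m > n`, whose limit is `x`. -/
def IsName (a : ℕ → List ℚ) (x : Ell2) : Prop :=
  (∀ n m, n < m → ‖finiteSeqVec (a n) - finiteSeqVec (a m)‖ < (2 : ℝ)⁻¹ ^ n) ∧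
    Tendsto (fun n => finiteSeqVec (a n)) atTop (𝓝 x)

/-- The sequence `x₀, x₁, …` in `ℓ₂` is computable: names of its elements are computable,
uniformly in the index. -/
def IsComputableSeq (x : ℕ → Ell2) : Prop :=
  ∃ a : ℕ → ℕ → List ℚ, (∀ i, IsName (a i) (x i)) ∧ Computable₂ fun i n => finiteSeqCode (a i n)

/-- The degree `d` computes the point `x` of `ℓ₂`: it computes some name of `x`. -/
def DegreeComputes (d : TuringDegree) (x : Ell2) : Prop :=
  ∃ a : ℕ → List ℚ, IsName a x ∧ degreeOf (fun n => finiteSeqCode (a n)) ≤ d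

/-- The sequence `x₀, x₁, …` converges weakly to `p`. -/
def ConvergesWeakly (x : ℕ → Ell2) (p : Ell2) : Prop :=
  ∀ y : Ell2, Tendsto (fun i => inner ℝ y (x i)) atTop (𝓝 (inner ℝ y p))

/-- `p` is a weak cluster point of the sequence `x₀, x₁, …`: some subsequence converges weakly
to `p`. -/
def IsWeakClusterPoint (x : ℕ → Ell2) (p : Ell2) : Prop :=
  ∃ φ : ℕ → ℕ, StrictMono φ ∧ ConvergesWeakly (x ∘ φ) p

/-! In a `Σ₂` definition `∃ v, ∀ s, R e v s` of the double jump, a number `v` that is not a witness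
for `e` is refuted in finite time, but a witness is never confirmed. Let the `i`-th vector of a
computable sequence have the value `2⁻ᵉ` at the coordinate `(e, v)` if `v` is the least candidate
for `e` that is not refuted before time `i`. The sequence is bounded, since every `e` has at most
one such candidate, and it converges coordinatewise, to `2⁻ᵉ` at the least true witnesses and to
`0` elsewhere. Every weak cluster point has these coordinates, so an approximation of it in norm,
up to a fraction of `2⁻ᵉ`, reveals whether `e` has a witness: the approximation is finitely
supported, which turns the unbounded search for a witness into a finite one.

Conversely, by weak compactness of closed balls, finitely many closed balls contain a common weak
cluster point of a bounded sequence if and only if, for every `n`, some member with index beyond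
`n` nearly lies in all of them as far as the first `n` coordinates can tell. This is a `Π₂`
condition, so the double jump can choose rational centers of balls with radii tending to `0` one
after the other, never losing the common weak cluster point. The centers converge to a weak cluster
point, since the set of weak cluster points is closed in norm.
-/

/-! ### Oracle programs -/

namespace OracleCode

open Nat.Partrec (Code)
open Encodable (encode)

/-- The partial function computed by a program whose oracle is itself a partial function. Finite
initial segments of an oracle are treated in this way. -/
def evalPart (p : ℕ → Part ℕ) : OracleCode → ℕ → Part ℕ
  | zero => fun _ => Part.some 0
  | succ => fun n => Part.some (n + 1)
  | left => fun n => Part.some n.unpair.1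
  | right => fun n => Part.some n.unpair.2
  | oracle => p
  | pair cf cg => fun n => (evalPart p cf n).bind fun u => (evalPart p cg n).map (Nat.pair u)
  | comp cf cg => fun n => (evalPart p cg n).bind (evalPart p cf)
  | prec cf cg => fun m =>
      m.unpair.2.rec (evalPart p cf m.unpair.1) fun y IH =>
        IH.bind fun i => evalPart p cg (Nat.pair m.unpair.1 (Nat.pair y i))
  | rfind' cf => fun m =>
      (Nat.rfind fun n => (evalPart p cf (Nat.pair m.unpair.1 (n + m.unpair.2))).map
        fun k => decide (k = 0)).map (· + m.unpair.2)

theorem evalPart_some (g : ℕ → ℕ) (c : OracleCode) :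
    evalPart (fun n => Part.some (g n)) c = eval g c := by
  induction c with
  | zero | succ | left | right | oracle => rfl
  | pair cf cg ihf ihg =>
    funext n
    have h : eval g (pair cf cg) n =
        Part.bind (Part.map Nat.pair (eval g cf n)) fun v => Part.map v (eval g cg n) := rfl
    rw [h, Part.bind_map, ← ihf, ← ihg]
    rfl
  | comp cf cg ihf ihg =>
    funext n
    change Part.bind _ _ = Part.bind (eval g cg n) (eval g cf)
    rw [← ihf, ← ihg]
  | prec cf cg ihf ihg =>
    funext n
    have h : eval g (prec cf cg) n =
        n.unpair.2.rec (eval g cf n.unpair.1) fun y IH => Part.bind IH fun i =>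
          eval g cg (Nat.pair n.unpair.1 (Nat.pair y i)) := rfl
    rw [h, ← ihf, ← ihg]
    rfl
  | rfind' cf ih =>
    funext n
    change _ = (Nat.rfind fun k => Part.map (fun k => decide (k = 0))
      (eval g cf (Nat.pair n.unpair.1 (k + n.unpair.2)))).map (· + n.unpair.2)
    rw [← ih]
    rfl

section EvalPart

variable {p : ℕ → Part ℕ} {cf cg : OracleCode}

theorem mem_evalPart_pair {n y : ℕ} : y ∈ evalPart p (pair cf cg) n ↔
    ∃ u ∈ evalPart p cf n, ∃ v ∈ evalPart p cg n, y = Nat.pair u v := by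
  simp [evalPart, eq_comm]

theorem mem_evalPart_comp {n y : ℕ} : y ∈ evalPart p (comp cf cg) n ↔
    ∃ u ∈ evalPart p cg n, y ∈ evalPart p cf u := by
  simp [evalPart]

theorem mem_evalPart_prec_zero {a y : ℕ} :
    y ∈ evalPart p (prec cf cg) (Nat.pair a 0) ↔ y ∈ evalPart p cf a := by
  simp [evalPart]

theorem mem_evalPart_prec_succ {a n y : ℕ} :
    y ∈ evalPart p (prec cf cg) (Nat.pair a (n + 1)) ↔
      ∃ i ∈ evalPart p (prec cf cg) (Nat.pair a n),
        y ∈ evalPart p cg (Nat.pair a (Nat.pair n i)) := by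
  simp [evalPart]

theorem mem_evalPart_rfind' {a m y : ℕ} :
    y ∈ evalPart p (rfind' cf) (Nat.pair a m) ↔
      ∃ n, (0 ∈ evalPart p cf (Nat.pair a (n + m)) ∧
        ∀ k < n, ∃ z ∈ evalPart p cf (Nat.pair a (k + m)), z ≠ 0) ∧ y = n + m := by
  simp only [evalPart, Nat.unpair_pair, Part.mem_map_iff]
  refine exists_congr fun n => and_congr (Nat.mem_rfind.trans ?_) eq_comm
  simp

end EvalPart

/- A halting computation asks finitely many questions, so it survives along every filter along
which each single answer survives. A principal filter gives monotonicity in the oracle, and the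
initial segments of a total oracle give the use principle. -/
theorem eventually_mem_evalPart {ι : Type*} {l : Filter ι} {p : ℕ → Part ℕ} {q : ι → ℕ → Part ℕ}
    (h : ∀ n, ∀ y ∈ p n, ∀ᶠ s in l, y ∈ q s n) (c : OracleCode) :
    ∀ n, ∀ y ∈ evalPart p c n, ∀ᶠ s in l, y ∈ evalPart (q s) c n := by
  induction c with
  | zero | succ | left | right => exact fun n y hy => .of_forall fun _ => hy
  | oracle => exact h
  | pair cf cg ihf ihg =>
    intro n y hy
    obtain ⟨u, hu, v, hv, rfl⟩ := mem_evalPart_pair.1 hy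
    filter_upwards [ihf _ _ hu, ihg _ _ hv] with s hu hv
    exact mem_evalPart_pair.2 ⟨u, hu, v, hv, rfl⟩
  | comp cf cg ihf ihg =>
    intro n y hy
    obtain ⟨u, hu, hy⟩ := mem_evalPart_comp.1 hy
    filter_upwards [ihg _ _ hu, ihf _ _ hy] with s hu hy
    exact mem_evalPart_comp.2 ⟨u, hu, hy⟩
  | prec cf cg ihf ihg =>
    intro n
    rw [← Nat.pair_unpair n]
    generalize n.unpair.1 = a
    induction n.unpair.2 with
    | zero => simpa only [mem_evalPart_prec_zero] using ihf a
    | succ n ih =>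
      intro y hy
      obtain ⟨i, hi, hy⟩ := mem_evalPart_prec_succ.1 hy
      filter_upwards [ih _ hi, ihg _ _ hy] with s hi hy
      exact mem_evalPart_prec_succ.2 ⟨i, hi, hy⟩
  | rfind' cf ih =>
    intro n y
    rw [← Nat.pair_unpair n, mem_evalPart_rfind']
    rintro ⟨k, ⟨hk, hlt⟩, rfl⟩
    choose! z hz hz0 using hlt
    have hlt : ∀ᶠ s in l, ∀ j ∈ Set.Iio k, z j ∈
        evalPart (q s) cf (Nat.pair n.unpair.1 (j + n.unpair.2)) :=
      (eventually_all_finite (Set.finite_Iio k)).2 fun j hj => ih _ _ (hz j hj)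
    filter_upwards [ih _ _ hk, hlt] with s hk hlt
    exact mem_evalPart_rfind'.2 ⟨k, ⟨hk, fun j hj => ⟨z j, hlt j hj, hz0 j hj⟩⟩, rfl⟩

/-- A list of numbers as a partial oracle, defined on the positions of the list. -/
def listOracle (l : List ℕ) : ℕ → Part ℕ := fun n => (l[n]? : Part ℕ)

theorem mem_listOracle_map_range {g : ℕ → ℕ} {k n y : ℕ} :
    y ∈ listOracle ((List.range k).map g) n ↔ n < k ∧ g n = y := by
  simp [listOracle, List.getElem?_eq_some_iff]

theorem mem_eval_iff_exists_listOracle {g : ℕ → ℕ} {c : OracleCode} {n y : ℕ} :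
    y ∈ eval g c n ↔ ∃ k, y ∈ evalPart (listOracle ((List.range k).map g)) c n := by
  rw [← evalPart_some]
  constructor
  · intro hy
    refine (eventually_mem_evalPart (l := atTop) (fun m z hz => ?_) c n y hy).exists
    filter_upwards [eventually_gt_atTop m] with k hk
    exact mem_listOracle_map_range.2 ⟨hk, (Part.mem_some_iff.1 hz).symm⟩
  · rintro ⟨k, hy⟩
    refine eventually_pure.1 (eventually_mem_evalPart (l := pure k)
      (q := fun _ m => Part.some (g m)) (fun m z hz => .of_forall fun _ => ?_) c n y hy)
    exact Part.mem_some_iff.2 (mem_listOracle_map_range.1 hz).2.symm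

/-! ### Eliminating a finite oracle -/

theorem exists_code_eval_pair_encode : ∃ c : Code, ∀ (l : List ℕ) (n : ℕ),
    c.eval (Nat.pair (encode l) n) = listOracle l n := by
  have h : Partrec fun m : ℕ =>
      (((Denumerable.ofNat (List ℕ) m.unpair.1)[m.unpair.2]? : Option ℕ) : Part ℕ) :=
    Computable.ofOption ((Primrec.list_getElem?.comp
      ((Primrec.ofNat _).comp (Primrec.fst.comp Primrec.unpair))
      (Primrec.snd.comp Primrec.unpair)).to_comp)
  obtain ⟨c, hc⟩ := Code.exists_code.1 (Partrec.nat_iff.1 h)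
  exact ⟨c, fun l n => by simp [hc, listOracle]⟩

/-- A program that maps `((s, a), x)` to `(s, (a, x))`. -/
def assocCode : Code :=
  .pair (.comp .left .left) (.pair (.comp .right .left) .right)

/-- A program that maps `(s, (a, x))` to `((s, a), x)`. -/
def assocSymmCode : Code :=
  .pair (.pair .left (.comp .left .right)) (.comp .right .right)

theorem code_eval_left (n : ℕ) : Code.left.eval n = Part.some n.unpair.1 := rfl

theorem code_eval_right (n : ℕ) : Code.right.eval n = Part.some n.unpair.2 := rfl

theorem code_eval_comp (c d : Code) (n : ℕ) :
    (Code.comp c d).eval n = (d.eval n).bind fun u => c.eval u := rfl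

theorem code_eval_pair (c d : Code) (n : ℕ) :
    (Code.pair c d).eval n = (c.eval n).bind fun u => (d.eval n).map (Nat.pair u) := by
  simp [Code.eval, Seq.seq]

theorem code_eval_rfind' (c : Code) (n : ℕ) : (Code.rfind' c).eval n =
    (Nat.rfind fun k => (c.eval (Nat.pair n.unpair.1 (k + n.unpair.2))).map
      fun m => decide (m = 0)).map (· + n.unpair.2) := rfl

theorem eval_assocCode (s a x : ℕ) :
    assocCode.eval (Nat.pair (Nat.pair s a) x) = Part.some (Nat.pair s (Nat.pair a x)) := by
  simp [assocCode, code_eval_pair, code_eval_comp, code_eval_left, code_eval_right]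

theorem eval_assocSymmCode (s a x : ℕ) :
    assocSymmCode.eval (Nat.pair s (Nat.pair a x)) = Part.some (Nat.pair (Nat.pair s a) x) := by
  simp [assocSymmCode, code_eval_pair, code_eval_comp, code_eval_left, code_eval_right]

/-- The program without oracle that simulates an oracle program on the arguments
`Nat.pair (encode l) n`, where `l` is the finite oracle and `n` the argument. -/
noncomputable def relativize : OracleCode → Code
  | zero => .zero
  | succ => .comp .succ .right
  | left => .comp .left .right
  | right => .comp .right .right
  | oracle => exists_code_eval_pair_encode.choose
  | pair cf cg => .pair (relativize cf) (relativize cg)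
  | comp cf cg => .comp (relativize cf) (.pair .left (relativize cg))
  | prec cf cg => .comp (.prec (relativize cf) (.comp (relativize cg) assocCode)) assocSymmCode
  | rfind' cf => .comp (.rfind' (.comp (relativize cf) assocCode)) assocSymmCode

theorem eval_relativize (l : List ℕ) (c : OracleCode) (n : ℕ) :
    (relativize c).eval (Nat.pair (encode l) n) = evalPart (listOracle l) c n := by
  induction c generalizing n with
  | zero => rfl
  | succ =>
    rw [relativize, code_eval_comp, code_eval_right, Part.bind_some, Nat.unpair_pair]
    rfl
  | left | right =>
    simp [relativize, code_eval_comp, code_eval_left, code_eval_right, evalPart]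
  | oracle => exact exists_code_eval_pair_encode.choose_spec l n
  | pair cf cg ihf ihg => simp only [relativize, code_eval_pair, evalPart, ihf, ihg]
  | comp cf cg ihf ihg =>
    simp [relativize, code_eval_comp, code_eval_pair, code_eval_left, evalPart, Part.bind_map,
      ihf, ihg]
  | prec cf cg ihf ihg =>
    rw [← Nat.pair_unpair n]
    generalize n.unpair.1 = a
    rw [relativize, code_eval_comp, eval_assocSymmCode, Part.bind_some]
    induction n.unpair.2 with
    | zero => simp [Code.eval_prec_zero, evalPart, ihf]
    | succ n ih => simp [Code.eval_prec_succ, ih, evalPart, code_eval_comp, eval_assocCode, ihg]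
  | rfind' cf ih =>
    rw [← Nat.pair_unpair n, relativize, code_eval_comp, eval_assocSymmCode, Part.bind_some]
    simp [code_eval_rfind', code_eval_comp, evalPart, eval_assocCode, ih]

/-! ### Gödel numbers -/

theorem div2_div2_lt_add_five (n : ℕ) : n.div2.div2 < n + 5 := by
  simp only [Nat.div2_val]
  omega

theorem ofNat_add_five (n : ℕ) : ofNat (n + 5) =
    cond n.bodd
      (cond n.div2.bodd (rfind' (ofNat n.div2.div2))
        (prec (ofNat n.div2.div2.unpair.1) (ofNat n.div2.div2.unpair.2)))
      (cond n.div2.bodd (comp (ofNat n.div2.div2.unpair.1) (ofNat n.div2.div2.unpair.2))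
        (pair (ofNat n.div2.div2.unpair.1) (ofNat n.div2.div2.unpair.2))) := by
  rw [ofNat]
  cases n.bodd <;> cases n.div2.bodd <;> rfl

/-- The index of a program. -/
def toNat : OracleCode → ℕ
  | zero => 0
  | succ => 1
  | left => 2
  | right => 3
  | oracle => 4
  | pair cf cg => 2 * (2 * Nat.pair (toNat cf) (toNat cg)) + 5
  | comp cf cg => 2 * (2 * Nat.pair (toNat cf) (toNat cg) + 1) + 5
  | prec cf cg => (2 * (2 * Nat.pair (toNat cf) (toNat cg)) + 1) + 5
  | rfind' cf => (2 * (2 * toNat cf + 1) + 1) + 5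

theorem ofNat_toNat (c : OracleCode) : ofNat (toNat c) = c := by
  induction c with
  | zero | succ | left | right | oracle => simp [toNat, ofNat]
  | _ => simp [toNat, ofNat_add_five, Nat.div2_val, *]

/-- The recursion step of `relativize` on Gödel numbers: computes the translation of program
`n + 5` from the list of translations of the programs with smaller number. -/
def relativizeStep (IH : List Code) (n : ℕ) : Option Code :=
  IH[n.div2.div2]?.bind fun s =>
  IH[n.div2.div2.unpair.1]?.bind fun s₁ =>
  IH[n.div2.div2.unpair.2]?.map fun s₂ =>
  cond n.bodd
    (cond n.div2.bodd (.comp (.rfind' (.comp s assocCode)) assocSymmCode)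
      (.comp (.prec s₁ (.comp s₂ assocCode)) assocSymmCode))
    (cond n.div2.bodd (.comp s₁ (.pair .left s₂)) (.pair s₁ s₂))

theorem relativizeStep_map_range (n : ℕ) :
    relativizeStep ((List.range (n + 5)).map fun e => relativize (ofNat e)) n =
      some (relativize (ofNat (n + 5))) := by
  have hm := div2_div2_lt_add_five n
  have hl := n.div2.div2.unpair_left_le.trans_lt hm
  have hr := n.div2.div2.unpair_right_le.trans_lt hm
  simp only [relativizeStep, List.getElem?_map, List.getElem?_range hm, List.getElem?_range hl,
    List.getElem?_range hr, Option.map_some, Option.bind_some, ofNat_add_five]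
  cases n.bodd <;> cases n.div2.bodd <;> rfl

section

open Primrec

theorem primrec₂_relativizeStep : Primrec₂ relativizeStep := by
  have hm : Primrec fun p : List Code × ℕ => p.2.div2.div2 := nat_div2.comp (nat_div2.comp snd)
  refine option_bind (list_getElem?.comp fst hm) <| .mk <|
    option_bind ((list_getElem?.comp fst (fst.comp (Primrec.unpair.comp hm))).comp fst) <| .mk <|
    option_map ((list_getElem?.comp fst (snd.comp (Primrec.unpair.comp hm))).comp
      (fst.comp fst)) <| .mk ?_
  have n : Primrec fun p : (((List Code × ℕ) × Code) × Code) × Code => p.1.1.1.2 :=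
    snd.comp (fst.comp (fst.comp fst))
  have s : Primrec fun p : (((List Code × ℕ) × Code) × Code) × Code => p.1.1.2 :=
    snd.comp (fst.comp fst)
  have s₁ : Primrec fun p : (((List Code × ℕ) × Code) × Code) × Code => p.1.2 := snd.comp fst
  have s₂ : Primrec fun p : (((List Code × ℕ) × Code) × Code) × Code => p.2 := snd
  exact (nat_bodd.comp n).cond
    ((nat_bodd.comp <| nat_div2.comp n).cond
      (Code.primrec₂_comp.comp
        (Code.primrec_rfind'.comp (Code.primrec₂_comp.comp s (const _))) (const _))
      (Code.primrec₂_comp.comp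
        (Code.primrec₂_prec.comp s₁ (Code.primrec₂_comp.comp s₂ (const _))) (const _)))
    ((nat_bodd.comp <| nat_div2.comp n).cond
      (Code.primrec₂_comp.comp s₁ (Code.primrec₂_pair.comp (const _) s₂))
      (Code.primrec₂_pair.comp s₁ s₂))

theorem primrec_relativize_ofNat : Primrec fun e => relativize (ofNat e) := by
  let base : List Code := (List.range 5).map fun e => relativize (ofNat e)
  have hstep : Primrec fun IH : List Code => base[IH.length]? <|>
      relativizeStep IH (IH.length - 5) :=
    option_orElse.comp (list_getElem?.comp (const base) list_length)
      (primrec₂_relativizeStep.comp .id (nat_sub.comp list_length (const 5)))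
  refine (nat_strong_rec (fun (_ : Unit) e => relativize (ofNat e)) (hstep.comp snd).to₂
    fun _ n => ?_).comp (const ()) .id
  rcases lt_or_ge n 5 with hn | hn
  · simp [base, List.getElem?_range hn]
  · obtain ⟨m, rfl⟩ := Nat.exists_eq_add_of_le' hn
    simp [base, relativizeStep_map_range]

end

/-- Whether the program with index `e` halts on `e` within `t` steps, with the finite oracle `l`. -/
noncomputable def haltsIn (t e : ℕ) (l : List ℕ) : Bool :=
  (Code.evaln t (relativize (ofNat e)) (Nat.pair (encode l) e)).isSome

theorem primrec_haltsIn : Primrec fun p : ℕ × ℕ × List ℕ => haltsIn p.1 p.2.1 p.2.2 := by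
  open Primrec in
  exact option_isSome.comp (Code.primrec_evaln.comp
    ((fst.pair (primrec_relativize_ofNat.comp (fst.comp snd))).pair
      (Primrec₂.natPair.comp (Primrec.encode.comp (snd.comp snd)) (fst.comp snd))))

theorem haltsIn_mono {s t e : ℕ} {l : List ℕ} (h : s ≤ t) (hs : haltsIn s e l) :
    haltsIn t e l := by
  obtain ⟨x, hx⟩ := Option.isSome_iff_exists.1 hs
  exact Option.isSome_iff_exists.2 ⟨x, Code.evaln_mono h hx⟩

theorem exists_haltsIn_iff_dom {e : ℕ} {l : List ℕ} :
    (∃ t, haltsIn t e l) ↔ (evalPart (listOracle l) (ofNat e) e).Dom := by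
  simp only [Part.dom_iff_mem, ← eval_relativize, Code.evaln_complete, haltsIn,
    Option.isSome_iff_exists]
  exact exists_comm

theorem mem_turingJump_iff_exists_haltsIn {A : Set ℕ} {e : ℕ} :
    e ∈ turingJump A ↔ ∃ k t, haltsIn t e ((List.range k).map (charFun A)) := by
  simp only [exists_haltsIn_iff_dom, turingJump, Set.mem_ofPred_eq, Part.dom_iff_mem,
    mem_eval_iff_exists_listOracle]
  exact exists_comm

end OracleCode

/-! ### The double jump is a `Σ₂` set -/

section

open OracleCode Primrec

theorem charFun_eq_zero_iff {A : Set ℕ} {n : ℕ} : charFun A n = 0 ↔ n ∉ A := by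
  simp [charFun]

theorem primrecPred_exists_lt {α : Type*} [Primcodable α] {R : ℕ → α → Prop} {f : α → ℕ}
    (hR : PrimrecRel R) (hf : Primrec f) : PrimrecPred fun a => ∃ x < f a, R x a :=
  (hR.exists_mem_list.comp (list_range.comp hf) .id).of_eq (by simp)

theorem primrecPred_forall_lt {α : Type*} [Primcodable α] {R : ℕ → α → Prop} {f : α → ℕ}
    (hR : PrimrecRel R) (hf : Primrec f) : PrimrecPred fun a => ∀ x < f a, R x a :=
  (hR.forall_mem_list.comp (list_range.comp hf) .id).of_eq (by simp)

theorem computablePred_comp {α β : Type*} [Primcodable α] [Primcodable β] {P : β → Prop}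
    (hP : ComputablePred P) {f : α → β} (hf : Computable f) : ComputablePred fun a => P (f a) :=
  let ⟨_, hdec⟩ := hP
  ⟨fun _ => inferInstance, hdec.comp hf⟩

theorem exists_primrec₂_eventually_eq_charFun_turingJump {A : Set ℕ} (hA : Primrec (charFun A)) :
    ∃ G : ℕ → ℕ → ℕ, Primrec₂ G ∧ ∀ e, ∀ᶠ s in atTop, G s e = charFun (turingJump A) e := by
  classical
  let stage (s e : ℕ) : Prop := ∃ k < s, haltsIn s e ((List.range k).map (charFun A)) = true
  have stage_mono {s t e : ℕ} (hst : s ≤ t) : stage s e → stage t e :=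
    fun ⟨k, hk, hs⟩ => ⟨k, hk.trans_le hst, haltsIn_mono hst hs⟩
  have mem_iff (e : ℕ) : e ∈ turingJump A ↔ ∃ s, stage s e := by
    rw [mem_turingJump_iff_exists_haltsIn]
    refine ⟨fun ⟨k, t, h⟩ => ⟨max (k + 1) t, k, ?_, haltsIn_mono (le_max_right _ _) h⟩,
      fun ⟨s, k, _, h⟩ => ⟨k, s, h⟩⟩
    exact k.lt_succ_self.trans_le (le_max_left _ _)
  have hstage : PrimrecPred fun p : ℕ × ℕ => stage p.1 p.2 := by
    refine primrecPred_exists_lt (R := fun k (p : ℕ × ℕ) =>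
      haltsIn p.1 p.2 ((List.range k).map (charFun A)) = true) (Primrec.eq.comp ?_ (const true)) fst
    exact primrec_haltsIn.comp ((fst.comp snd).pair ((snd.comp snd).pair
      (list_map (list_range.comp fst) (hA.comp snd).to₂)))
  refine ⟨fun s e => if stage s e then 1 else 0, ite hstage (const 1) (const 0), fun e => ?_⟩
  by_cases he : e ∈ turingJump A
  · obtain ⟨s, hs⟩ := (mem_iff e).1 he
    filter_upwards [eventually_ge_atTop s] with t hst
    simp [stage_mono hst hs, charFun, he]
  · have hstage (s : ℕ) : ¬ stage s e := fun h => he ((mem_iff e).2 ⟨s, h⟩)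
    simp [hstage, charFun, he]

theorem exists_primrecPred_mem_turingJump_iff_exists_forall {A : Set ℕ} {G : ℕ → ℕ → ℕ}
    (hG : Primrec₂ G) (hlim : ∀ e, ∀ᶠ s in atTop, G s e = charFun A e) :
    ∃ R : ℕ → ℕ → ℕ → Prop, PrimrecPred (fun p : (ℕ × ℕ) × ℕ => R p.1.1 p.1.2 p.2) ∧
      ∀ e, e ∈ turingJump A ↔ ∃ v, ∀ s, R e v s := by
  have eventually_map_eq (k : ℕ) :
      ∀ᶠ s in atTop, (List.range k).map (G s) = (List.range k).map (charFun A) := by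
    have h : ∀ᶠ s in atTop, ∀ e ∈ Set.Iio k, G s e = charFun A e :=
      (eventually_all_finite (Set.finite_Iio k)).2 fun e _ => hlim e
    filter_upwards [h] with s hs
    exact List.map_congr_left fun e he => hs e (List.mem_range.1 he)
  -- The witness `v` codes the length of the oracle, the running time, and a stage from which on
  -- the approximation of this part of the oracle is correct.
  refine ⟨fun e v s => s < v.unpair.2.unpair.2 ∨
    haltsIn v.unpair.2.unpair.1 e ((List.range v.unpair.1).map (G s)) = true, ?_, fun e => ?_⟩
  · have v : Primrec fun p : (ℕ × ℕ) × ℕ => p.1.2.unpair := unpair.comp (snd.comp fst)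
    have w : Primrec fun p : (ℕ × ℕ) × ℕ => p.1.2.unpair.2.unpair := unpair.comp (snd.comp v)
    exact (nat_lt.comp snd (snd.comp w)).or (Primrec.eq.comp (primrec_haltsIn.comp
      ((fst.comp w).pair ((fst.comp fst).pair (list_map (list_range.comp (fst.comp v))
        (hG.comp (snd.comp fst) snd).to₂)))) (const true))
  rw [mem_turingJump_iff_exists_haltsIn]
  constructor
  · rintro ⟨k, t, h⟩
    obtain ⟨s₀, hs₀⟩ := eventually_atTop.1 (eventually_map_eq k)
    refine ⟨Nat.pair k (Nat.pair t s₀), fun s => ?_⟩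
    simp only [Nat.unpair_pair]
    exact (lt_or_ge s s₀).imp_right fun hs => by rw [hs₀ s hs, h]
  · rintro ⟨v, hv⟩
    obtain ⟨s₀, hs₀⟩ := eventually_atTop.1 (eventually_map_eq v.unpair.1)
    refine ⟨v.unpair.1, v.unpair.2.unpair.1, ?_⟩
    rw [← hs₀ _ (le_max_left s₀ v.unpair.2.unpair.2)]
    exact (hv _).resolve_left (le_max_right _ _).not_gt

theorem exists_primrecPred_mem_doubleJump_iff_exists_forall :
    ∃ R : ℕ → ℕ → ℕ → Prop, PrimrecPred (fun p : (ℕ × ℕ) × ℕ => R p.1.1 p.1.2 p.2) ∧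
      ∀ e, e ∈ turingJump (turingJump ∅) ↔ ∃ v, ∀ s, R e v s := by
  have hempty : Primrec (charFun ∅) := (const 0).of_eq fun n => by simp [charFun]
  obtain ⟨G, hG, hlim⟩ := exists_primrec₂_eventually_eq_charFun_turingJump hempty
  exact exists_primrecPred_mem_turingJump_iff_exists_forall hG hlim

end

/-! ### Computability in a degree -/

section

variable {d : TuringDegree} {f g : ℕ → ℕ}

theorem degreeOf_le_toAntisymmetrization_iff {h : ℕ →. ℕ} :
    degreeOf f ≤ toAntisymmetrization TuringReducible h ↔
      Nat.RecursiveIn {h} fun n => Part.some (f n) :=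
  RecursiveIn.iff_nat

theorem degreeOf_le_of_computable (hf : Computable f) : degreeOf f ≤ d := by
  induction d using Quotient.inductionOn
  exact degreeOf_le_toAntisymmetrization_iff.2 (Partrec.nat_iff.1 hf).recursiveIn

theorem degreeOf_comp_le (hf : degreeOf f ≤ d) (hg : degreeOf g ≤ d) :
    degreeOf (fun n => f (g n)) ≤ d := by
  induction d using Quotient.inductionOn
  have hf := degreeOf_le_toAntisymmetrization_iff.1 hf
  have hg := degreeOf_le_toAntisymmetrization_iff.1 hg
  exact degreeOf_le_toAntisymmetrization_iff.2 <| (hf.comp hg).of_eq fun n =>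
    Part.bind_some (g n) fun m => Part.some (f m)

theorem degreeOf_pair_le (hf : degreeOf f ≤ d) (hg : degreeOf g ≤ d) :
    degreeOf (fun n => Nat.pair (f n) (g n)) ≤ d := by
  induction d using Quotient.inductionOn
  have hf := degreeOf_le_toAntisymmetrization_iff.1 hf
  have hg := degreeOf_le_toAntisymmetrization_iff.1 hg
  exact degreeOf_le_toAntisymmetrization_iff.2 <| (hf.pair hg).of_eq fun n => by simp [Seq.seq]

theorem degreeOf_find_le (hf : degreeOf f ≤ d) (h : ∀ w, ∃ n, f (Nat.pair w n) = 0) :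
    degreeOf (fun w => Nat.find (h w)) ≤ d := by
  induction d using Quotient.inductionOn
  have hf := degreeOf_le_toAntisymmetrization_iff.1 hf
  refine degreeOf_le_toAntisymmetrization_iff.2 <| hf.rfind.of_eq fun w => Part.eq_some_iff.2 ?_
  refine Nat.mem_rfind.2 ⟨?_, fun {m} hm => ?_⟩
  · simpa using Nat.find_spec (h w)
  · simpa using Nat.find_min (h w) hm

theorem degreeOf_iterate_le (hf : degreeOf f ≤ d) (a : ℕ) : degreeOf (fun n => f^[n] a) ≤ d := by
  have hstep : degreeOf (fun m => f m.unpair.2.unpair.2) ≤ d := degreeOf_comp_le hf <|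
    degreeOf_le_of_computable (Computable.snd.comp
      (Computable.unpair.comp (Computable.snd.comp Computable.unpair)))
  have hconst : degreeOf (fun _ => a) ≤ d := degreeOf_le_of_computable (Computable.const a)
  have hpair : degreeOf (fun n => Nat.pair 0 n) ≤ d :=
    degreeOf_le_of_computable (Primrec₂.natPair.comp (.const 0) .id).to_comp
  induction d using Quotient.inductionOn
  have hrec := ((degreeOf_le_toAntisymmetrization_iff.1 hconst).prec
    (degreeOf_le_toAntisymmetrization_iff.1 hstep)).comp
      (degreeOf_le_toAntisymmetrization_iff.1 hpair)
  refine degreeOf_le_toAntisymmetrization_iff.2 <| hrec.of_eq fun n => ?_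
  simp only [Part.bind_eq_bind, Part.bind_some, Nat.unpair_pair]
  induction n with
  | zero => rfl
  | succ n ih => rw [Function.iterate_succ_apply']; simp only [ih, Part.bind_some]

end

namespace OracleCode

variable {g : ℕ → ℕ}

theorem eval_pair_of_eq_some {cf cg : OracleCode} {n u v : ℕ}
    (hf : eval g cf n = Part.some u) (hg : eval g cg n = Part.some v) :
    eval g (pair cf cg) n = Part.some (Nat.pair u v) := by
  rw [← evalPart_some] at *
  simp only [evalPart, hf, hg, Part.bind_some, Part.map_some]

theorem eval_comp_of_eq_some {cf cg : OracleCode} {n u : ℕ} (hg : eval g cg n = Part.some u) :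
    eval g (comp cf cg) n = eval g cf u := by
  simp only [← evalPart_some] at hg ⊢
  simp only [evalPart, hg, Part.bind_some]

theorem exists_eval_eq {f : ℕ →. ℕ} (hf : Nat.RecursiveIn {fun n => Part.some (g n)} f) :
    ∃ c : OracleCode, eval g c = f := by
  induction hf with
  | zero => exact ⟨zero, rfl⟩
  | succ => exact ⟨succ, rfl⟩
  | left => exact ⟨left, rfl⟩
  | right => exact ⟨right, rfl⟩
  | oracle h hh => exact ⟨oracle, (Set.mem_singleton_iff.1 hh).symm⟩
  | pair _ _ ihf ihg =>
    obtain ⟨cf, rfl⟩ := ihf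
    obtain ⟨cg, rfl⟩ := ihg
    exact ⟨pair cf cg, rfl⟩
  | comp _ _ ihf ihg =>
    obtain ⟨cf, rfl⟩ := ihf
    obtain ⟨cg, rfl⟩ := ihg
    exact ⟨comp cf cg, rfl⟩
  | prec _ _ ihf ihg =>
    obtain ⟨cf, rfl⟩ := ihf
    obtain ⟨cg, rfl⟩ := ihg
    exact ⟨prec cf cg, rfl⟩
  | rfind _ ih =>
    obtain ⟨c, rfl⟩ := ih
    refine ⟨comp (rfind' c) (pair (pair left right) zero), funext fun n => ?_⟩
    have hn : eval g (pair (pair left right) zero) n = Part.some (Nat.pair n 0) := by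
      have h := eval_pair_of_eq_some (g := g) (cf := left) (cg := right) (n := n) rfl rfl
      rw [Nat.pair_unpair] at h
      exact eval_pair_of_eq_some h rfl
    rw [eval_comp_of_eq_some hn, ← evalPart_some]
    simp only [evalPart, Nat.unpair_pair, add_zero]
    refine (Part.map_id' (fun _ => rfl) _).trans ?_
    rw [evalPart_some]
    rfl

/-- A program for a constant function. -/
def const : ℕ → OracleCode
  | 0 => zero
  | n + 1 => comp succ (const n)

theorem eval_const (w n : ℕ) : eval g (const w) n = Part.some w := by
  induction w with
  | zero => rfl
  | succ w ih => rw [const, eval_comp_of_eq_some ih]; rfl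

theorem primrec_toNat_comp (c : OracleCode) {h : ℕ → OracleCode}
    (hh : Primrec fun w => toNat (h w)) : Primrec fun w => toNat (comp c (h w)) := by
  open Primrec in
  exact nat_add.comp (nat_double.comp (nat_double_succ.comp
    (Primrec₂.natPair.comp (.const (toNat c)) hh))) (.const 5)

theorem primrec_toNat_const : Primrec fun w => toNat (const w) := by
  open Primrec in
  have h : Primrec₂ fun (_ : ℕ) (y : ℕ) => 2 * (2 * Nat.pair 1 y + 1) + 5 :=
    nat_add.comp (nat_double.comp (nat_double_succ.comp
      (Primrec₂.natPair.comp (.const 1) snd))) (.const 5)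
  refine (nat_rec₁ 0 h).of_eq fun w => ?_
  induction w with
  | zero => rfl
  | succ w ih => simp only [ih, const, toNat]

end OracleCode

section

open OracleCode Encodable

variable {d : TuringDegree} {A B : Set ℕ} {α : Type*} [Primcodable α]

theorem exists_primrec_mem_turingJump_iff_dom {f : ℕ →. ℕ}
    (hf : Nat.RecursiveIn {fun n => Part.some (charFun A n)} f) :
    ∃ h : ℕ → ℕ, Primrec h ∧ ∀ w, h w ∈ turingJump A ↔ (f w).Dom := by
  obtain ⟨c, rfl⟩ := exists_eval_eq hf
  refine ⟨fun w => toNat (comp c (const w)), primrec_toNat_comp c primrec_toNat_const, fun w => ?_⟩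
  rw [turingJump, Set.mem_ofPred_eq, ofNat_toNat, eval_comp_of_eq_some (eval_const _ _)]

theorem degreeOf_charFun_diff_le (hA : degreeOf (charFun A) ≤ d) (hB : degreeOf (charFun B) ≤ d) :
    degreeOf (charFun (A \ B)) ≤ d := by
  have hsub : degreeOf (fun m => m.unpair.1 - m.unpair.2) ≤ d := degreeOf_le_of_computable
    (Primrec.nat_sub.comp (.comp .fst .unpair) (.comp .snd .unpair)).to_comp
  convert degreeOf_comp_le hsub (degreeOf_pair_le hA hB) using 2
  funext n
  by_cases hA : n ∈ A <;> by_cases hB : n ∈ B <;> simp [charFun, hA, hB]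

theorem degreeOf_charFun_image_encode_le {P : α → Prop} (hP : ComputablePred P) :
    degreeOf (charFun (encode '' {a | P a})) ≤ d := by
  classical
  have h : Computable fun n => Option.casesOn (motive := fun _ => ℕ) (decode₂ α n) 0
      fun a => bif decide (P a) then 1 else 0 :=
    Computable.option_casesOn Primrec.decode₂.to_comp (.const 0)
      ((hP.decide.comp .snd).cond (.const 1) (.const 0)).to₂
  convert degreeOf_le_of_computable h using 2
  funext n
  rcases hn : decode₂ α n with - | a
  · have hn : ∀ a : α, encode a ≠ n := fun a ha => by simp [← ha] at hn
    simp [charFun, Set.indicator, hn]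
  · obtain rfl := decode₂_eq_some.1 hn
    by_cases ha : P a <;> simp [charFun, Set.indicator, ha]

theorem degreeOf_charFun_image_encode_compl_le {S : Set α}
    (hS : degreeOf (charFun (encode '' S)) ≤ d) : degreeOf (charFun (encode '' Sᶜ)) ≤ d := by
  have htrue : ComputablePred fun _ : α => True := ⟨inferInstance, .const true⟩
  rw [Set.compl_eq_univ_sdiff, Set.image_sdiff encode_injective]
  exact degreeOf_charFun_diff_le (degreeOf_charFun_image_encode_le htrue) hS

theorem rfind_dom_iff {f : ℕ → ℕ} :
    (Nat.rfind fun n => (fun m => decide (m = 0)) <$> Part.some (f n)).Dom ↔ ∃ n, f n = 0 := by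
  refine Nat.rfind_dom.trans ⟨fun ⟨n, hn, _⟩ => ⟨n, by simpa using hn⟩,
    fun ⟨n, hn⟩ => ⟨n, by simpa using hn, fun _ => trivial⟩⟩

theorem degreeOf_charFun_image_encode_exists_le {S : Set (α × ℕ)}
    (hS : degreeOf (charFun (encode '' S)) ≤ degreeOf (charFun A)) :
    degreeOf (charFun (encode '' {a | ∃ n, (a, n) ∈ S})) ≤ degreeOf (charFun (turingJump A)) := by
  have hnot : degreeOf (fun n => 1 - n) ≤ degreeOf (charFun A) :=
    degreeOf_le_of_computable (Primrec.nat_sub.comp (.const 1) .id).to_comp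
  have hsearch := (degreeOf_le_toAntisymmetrization_iff.1 (degreeOf_comp_le hnot hS)).rfind
  obtain ⟨h, hh, h_mem⟩ := exists_primrec_mem_turingJump_iff_dom hsearch
  convert degreeOf_comp_le (f := charFun (turingJump A)) le_rfl
    (degreeOf_le_of_computable hh.to_comp) using 2
  funext w
  have key : w ∈ encode '' {a | ∃ n, (a, n) ∈ S} ↔ h w ∈ turingJump A := by
    refine Iff.trans ?_ ((h_mem w).trans rfind_dom_iff).symm
    simp only [Nat.sub_eq_zero_iff_le, Nat.one_le_iff_ne_zero, ne_eq, charFun_eq_zero_iff, not_not]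
    constructor
    · rintro ⟨a, ⟨n, hn⟩, rfl⟩
      exact ⟨n, (a, n), hn, rfl⟩
    · rintro ⟨n, ⟨a, m⟩, hm, h⟩
      obtain ⟨rfl, -⟩ := Nat.pair_eq_pair.1 (show Nat.pair (encode a) m = Nat.pair w n from h)
      exact ⟨a, ⟨m, hm⟩, rfl⟩
  by_cases hw : h w ∈ turingJump A <;> simp [charFun, Set.indicator, key, hw]

theorem degreeOf_charFun_image_encode_forall_exists_le {R : α → ℕ → ℕ → Prop}
    (hR : ComputablePred fun p : (α × ℕ) × ℕ => R p.1.1 p.1.2 p.2) :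
    degreeOf (charFun (encode '' {a | ∀ n, ∃ i, R a n i})) ≤ zeroDoubleJump := by
  have hcompl : {a | ∀ n, ∃ i, R a n i} =
      {a | ∃ n, (a, n) ∈ {q : α × ℕ | ∃ i, (q, i) ∈ {p : (α × ℕ) × ℕ | R p.1.1 p.1.2 p.2}}ᶜ}ᶜ := by
    ext a
    simp
  rw [hcompl]
  refine degreeOf_charFun_image_encode_compl_le <| degreeOf_charFun_image_encode_exists_le <|
    degreeOf_charFun_image_encode_compl_le <| degreeOf_charFun_image_encode_exists_le ?_
  exact degreeOf_charFun_image_encode_le hR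

end

section

open Encodable

variable {d : TuringDegree} {A : Set ℕ} {α : Type*} [Primcodable α] {G : Set (List α)}

theorem encode_map_encode (L : List α) : encode (L.map encode) = encode L := by
  induction L with
  | nil => rfl
  | cons a L ih => simp [ih]

/-- The code of the list obtained by appending an element with code `n` to the list with
code `u`. -/
def concatCode (u n : ℕ) : ℕ :=
  encode (Denumerable.ofNat (List ℕ) u ++ [n])

theorem primrec₂_concatCode : Primrec₂ concatCode :=
  Primrec.encode.comp (Primrec.list_concat.comp ((Primrec.ofNat _).comp Primrec.fst) Primrec.snd)

theorem concatCode_encode (L : List α) (n : ℕ) :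
    concatCode (encode L) n = encode (L.map encode ++ [n]) := by
  rw [concatCode, ← encode_map_encode L, Denumerable.ofNat_encode]

theorem concatCode_encode_encode (L : List α) (a : α) :
    concatCode (encode L) (encode a) = encode (L ++ [a]) := by
  rw [concatCode_encode, ← encode_map_encode (L ++ [a]), List.map_append, List.map_singleton]

theorem exists_concatCode_eq_iff {L M : List α} {n : ℕ} :
    encode M = concatCode (encode L) n ↔ ∃ a, encode a = n ∧ M = L ++ [a] := by
  refine ⟨fun h => ?_, fun ⟨a, ha, hM⟩ => by rw [hM, ← ha, concatCode_encode_encode]⟩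
  rw [concatCode_encode, ← encode_map_encode, encode_inj] at h
  obtain ⟨L', K, rfl, hL', hK⟩ := List.map_eq_append_iff.1 h
  obtain ⟨a, rfl, ha⟩ := List.map_eq_singleton_iff.1 hK
  exact ⟨a, ha, by rw [List.map_injective_iff.2 encode_injective hL']⟩

theorem degreeOf_charFun_preimage_le {h : ℕ → ℕ} (hA : degreeOf (charFun A) ≤ d)
    (hh : degreeOf h ≤ d) : degreeOf (charFun (h ⁻¹' A)) ≤ d :=
  degreeOf_comp_le (f := charFun A) hA hh

theorem degreeOf_charFun_setOf_rel_apply_le {P : ℕ → α → Prop}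
    (hP : ComputablePred fun p : ℕ × α => P p.1 p.2) {a : ℕ → α}
    (ha : degreeOf (fun n => encode (a n)) ≤ d) : degreeOf (charFun {n | P n (a n)}) ≤ d := by
  convert degreeOf_charFun_preimage_le (degreeOf_charFun_image_encode_le hP)
    (degreeOf_pair_le (degreeOf_le_of_computable .id) ha) using 3
  ext n
  exact encode_injective.mem_set_image (s := {p : ℕ × α | P p.1 p.2}) (a := (n, a n)) |>.symm

/- The search for the next element is made total by accepting everything after a list outside of
`G`. -/
theorem exists_degreeOf_le_forall_concat_mem (hG : degreeOf (charFun (encode '' G)) ≤ d)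
    (hstep : ∀ L ∈ G, ∃ a, L ++ [a] ∈ G) :
    ∃ next : ℕ → ℕ, degreeOf next ≤ d ∧
      ∀ L ∈ G, ∃ a, encode a = next (encode L) ∧ L ++ [a] ∈ G := by
  let rejected : Set ℕ :=
    (fun m => m.unpair.1) ⁻¹' (encode '' G) \
      (fun m => concatCode m.unpair.1 m.unpair.2) ⁻¹' (encode '' G)
  have hrejected : degreeOf (charFun rejected) ≤ d := degreeOf_charFun_diff_le
    (degreeOf_charFun_preimage_le hG (degreeOf_le_of_computable (Computable.fst.comp .unpair)))
    (degreeOf_charFun_preimage_le hG (degreeOf_le_of_computable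
      (primrec₂_concatCode.comp (.comp .fst .unpair) (.comp .snd .unpair)).to_comp))
  have accepted_iff (u n : ℕ) : charFun rejected (Nat.pair u n) = 0 ↔
      (u ∈ encode '' G → concatCode u n ∈ encode '' G) := by
    simp only [charFun_eq_zero_iff, rejected, Set.mem_sdiff, Set.mem_preimage, Nat.unpair_pair,
      not_and, not_not]
  have hsearch (u : ℕ) : ∃ n, charFun rejected (Nat.pair u n) = 0 := by
    simp only [accepted_iff]
    by_cases hu : u ∈ encode '' G
    · obtain ⟨L, hL, rfl⟩ := hu
      obtain ⟨a, ha⟩ := hstep L hL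
      exact ⟨encode a, fun _ => ⟨L ++ [a], ha, (concatCode_encode_encode L a).symm⟩⟩
    · exact ⟨0, fun h => absurd h hu⟩
  refine ⟨fun u => Nat.find (hsearch u), degreeOf_find_le hrejected hsearch, fun L hL => ?_⟩
  obtain ⟨M, hM, hconcat⟩ :=
    (accepted_iff _ _).1 (Nat.find_spec (hsearch (encode L))) ⟨L, hL, rfl⟩
  obtain ⟨a, ha, rfl⟩ := exists_concatCode_eq_iff.1 hconcat
  exact ⟨a, ha, hM⟩

theorem exists_sequence_forall_map_range_mem (hG : degreeOf (charFun (encode '' G)) ≤ d)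
    (hnil : [] ∈ G) (hstep : ∀ L ∈ G, ∃ a, L ++ [a] ∈ G) :
    ∃ c : ℕ → α, degreeOf (fun n => encode (c n)) ≤ d ∧ ∀ m, (List.range m).map c ∈ G := by
  obtain ⟨next, hnext, next_spec⟩ := exists_degreeOf_le_forall_concat_mem hG hstep
  choose elem encode_elem elem_mem using fun L : G => next_spec L L.2
  let prefixes (m : ℕ) : G := (fun L => ⟨L ++ [elem L], elem_mem L⟩)^[m] ⟨[], hnil⟩
  have prefixes_succ (m : ℕ) :
      (prefixes (m + 1) : List α) = prefixes m ++ [elem (prefixes m)] :=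
    congrArg Subtype.val (Function.iterate_succ_apply' _ _ _)
  have encode_prefixes (m : ℕ) :
      encode (prefixes m : List α) =
        (fun u => concatCode u (next u))^[m] (encode ([] : List α)) := by
    induction m with
    | zero => rfl
    | succ m ih =>
      rw [prefixes_succ, Function.iterate_succ_apply', ← ih, ← encode_elem,
        concatCode_encode_encode]
  have map_range_eq (m : ℕ) : (List.range m).map (fun n => elem (prefixes n)) = prefixes m := by
    induction m with
    | zero => rfl
    | succ m ih => rw [List.range_succ, List.map_append, ih, List.map_singleton, prefixes_succ]
  refine ⟨fun n => elem (prefixes n), ?_, fun m => map_range_eq m ▸ (prefixes m).2⟩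
  have hconcat : degreeOf (fun u => concatCode u (next u)) ≤ d := by
    simpa using degreeOf_comp_le (f := fun m : ℕ => concatCode m.unpair.1 m.unpair.2)
      (degreeOf_le_of_computable (primrec₂_concatCode.comp
      (Primrec.fst.comp Primrec.unpair) (Primrec.snd.comp Primrec.unpair)).to_comp)
      (degreeOf_pair_le (degreeOf_le_of_computable Computable.id) hnext)
  simp only [encode_elem, encode_prefixes]
  exact degreeOf_comp_le hnext (degreeOf_iterate_le hconcat _)

end

/-! ### Weak cluster points in `ℓ₂` -/

section

variable {x b : ℕ → Ell2} {p : Ell2} {C : ℝ}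

theorem sum_sq_le_norm_sq (f : Ell2) (s : Finset ℕ) : ∑ j ∈ s, f j ^ 2 ≤ ‖f‖ ^ 2 := by
  simpa using lp.sum_rpow_le_norm_rpow (p := 2) (by norm_num) f s

theorem norm_le_of_forall_sum_range_sq_le {f : Ell2} (hC : 0 ≤ C)
    (h : ∀ n, ∑ j ∈ Finset.range n, f j ^ 2 ≤ C ^ 2) : ‖f‖ ≤ C := by
  refine lp.norm_le_of_forall_sum_le (p := 2) (by norm_num) hC fun s => ?_
  obtain ⟨n, hn⟩ := s.exists_nat_subset_range
  have hs := (Finset.sum_le_sum_of_subset_of_nonneg hn fun j _ _ => sq_nonneg (f j)).trans (h n)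
  simpa using hs

theorem finiteSeqVec_apply (r : List ℚ) (j : ℕ) : finiteSeqVec r j = ((r.getD j 0 : ℚ) : ℝ) :=
  rfl

theorem sum_single_eq_finiteSeqVec (q : ℕ → ℚ) (n : ℕ) :
    ∑ j ∈ Finset.range n, lp.single 2 j (q j : ℝ) = finiteSeqVec ((List.range n).map q) := by
  ext k
  rw [lp.coeFn_sum, Finset.sum_apply, finiteSeqVec_apply]
  by_cases hk : k < n <;> simp [Pi.single_apply, List.getD, hk]

theorem denseRange_finiteSeqVec : DenseRange finiteSeqVec := by
  intro f
  let truncation (n : ℕ) (v : ℕ → ℝ) : Ell2 := ∑ j ∈ Finset.range n, lp.single 2 j (v j)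
  have htruncation (n : ℕ) : Continuous (truncation n) :=
    continuous_finsetSum _ fun j _ =>
      (lp.isometry_single (E := fun _ : ℕ => ℝ) j).continuous.comp (continuous_apply j)
  have hdense : DenseRange fun (q : ℕ → ℚ) j => (q j : ℝ) :=
    DenseRange.piMap fun _ => Rat.denseRange_cast
  have hlim : Tendsto (fun n => truncation n f) atTop (𝓝 f) :=
    (lp.hasSum_single (E := fun _ : ℕ => ℝ) (p := 2) (by norm_num) f).tendsto_sum_nat
  refine isClosed_closure.mem_of_tendsto hlim (Eventually.of_forall fun n => ?_)
  refine map_mem_closure (htruncation n) (hdense f) ?_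
  rintro _ ⟨q, rfl⟩
  exact ⟨_, (sum_single_eq_finiteSeqVec q n).symm⟩

instance separableSpace_ell2 : TopologicalSpace.SeparableSpace Ell2 :=
  .of_denseRange _ denseRange_finiteSeqVec

theorem ConvergesWeakly.comp_tendsto (h : ConvergesWeakly x p) {φ : ℕ → ℕ}
    (hφ : Tendsto φ atTop atTop) : ConvergesWeakly (x ∘ φ) p :=
  fun y => (h y).comp hφ

theorem ConvergesWeakly.tendsto_apply (h : ConvergesWeakly x p) (j : ℕ) :
    Tendsto (fun i => x i j) atTop (𝓝 (p j)) := by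
  simpa [lp.inner_single_left] using h (lp.single 2 j (1 : ℝ))

theorem ConvergesWeakly.tendsto_sum_sq_sub (h : ConvergesWeakly x p) (q : Ell2) (n : ℕ) :
    Tendsto (fun i => ∑ j ∈ Finset.range n, (x i j - q j) ^ 2) atTop
      (𝓝 (∑ j ∈ Finset.range n, (p j - q j) ^ 2)) :=
  tendsto_finsetSum _ fun j _ => ((h.tendsto_apply j).sub_const _).pow 2

theorem exists_subseq_convergesWeakly (hC : ∀ i, ‖x i‖ ≤ C) :
    ∃ p, ∃ φ : ℕ → ℕ, StrictMono φ ∧ ConvergesWeakly (x ∘ φ) p := by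
  obtain ⟨ℓ, -, φ, hφ, hlim⟩ := WeakDual.isSeqCompact_closedBall ℝ Ell2 0 C
    (x := fun i => StrongDual.toWeakDual (InnerProductSpace.toDual ℝ Ell2 (x i)))
    fun i => by simpa using hC i
  refine ⟨(InnerProductSpace.toDual ℝ Ell2).symm (WeakDual.toStrongDual ℓ), φ, hφ, fun y => ?_⟩
  simp only [real_inner_comm _ y, InnerProductSpace.toDual_symm_apply]
  exact (WeakBilin.eval_continuous _ y).tendsto ℓ |>.comp hlim

theorem isWeakClusterPoint_of_tendsto {φ : ℕ → ℕ} (hφ : Tendsto φ atTop atTop)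
    (h : ConvergesWeakly (x ∘ φ) p) : IsWeakClusterPoint x p := by
  obtain ⟨ψ, hψ, hφψ⟩ := strictMono_subseq_of_tendsto_atTop hφ
  exact ⟨φ ∘ ψ, hφψ, h.comp_tendsto hψ.tendsto_atTop⟩

theorem IsWeakClusterPoint.of_tendsto_sub (hp : IsWeakClusterPoint b p)
    (h : Tendsto (fun i => x i - b i) atTop (𝓝 0)) : IsWeakClusterPoint x p := by
  obtain ⟨φ, hφ, hlim⟩ := hp
  refine ⟨φ, hφ, fun y => ?_⟩
  have hsub : Tendsto (fun k => inner ℝ y (x (φ k) - b (φ k))) atTop (𝓝 (inner ℝ y 0)) :=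
    tendsto_const_nhds.inner (h.comp hφ.tendsto_atTop)
  simpa [inner_sub_right] using hsub.add (hlim y)

/- The slack `2⁻ⁿ`, which disappears in the limit, allows the strict inequality that holds along a
weakly convergent subsequence. -/
theorem exists_isWeakClusterPoint_forall_norm_sub_le_iff {ι : Type*} [Finite ι]
    (hC : ∀ i, ‖b i‖ ≤ C) {c : ι → Ell2} {ρ : ι → ℝ} (hρ : ∀ s, 0 ≤ ρ s) :
    (∃ p, IsWeakClusterPoint b p ∧ ∀ s, ‖p - c s‖ ≤ ρ s) ↔
      ∀ n, ∃ i, n < i ∧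
        ∀ s, ∑ j ∈ Finset.range n, (b i j - c s j) ^ 2 < ρ s ^ 2 + (2 : ℝ)⁻¹ ^ n := by
  constructor
  · rintro ⟨p, ⟨φ, hφ, hlim⟩, hp⟩ n
    have hclose : ∀ᶠ k in atTop, ∀ s,
        ∑ j ∈ Finset.range n, (b (φ k) j - c s j) ^ 2 < ρ s ^ 2 + (2 : ℝ)⁻¹ ^ n := by
      refine eventually_all.2 fun s => (hlim.tendsto_sum_sq_sub (c s) n).eventually_lt_const ?_
      calc ∑ j ∈ Finset.range n, (p j - c s j) ^ 2
          ≤ ‖p - c s‖ ^ 2 := sum_sq_le_norm_sq (p - c s) _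
        _ ≤ ρ s ^ 2 := by gcongr; exact hp s
        _ < ρ s ^ 2 + (2 : ℝ)⁻¹ ^ n := lt_add_of_pos_right _ (by positivity)
    obtain ⟨k, hk, hnk⟩ := (hclose.and (hφ.tendsto_atTop.eventually_gt_atTop n)).exists
    exact ⟨φ k, hnk, hk⟩
  · intro h
    choose θ hθ hclose using h
    obtain ⟨p, φ, hφ, hlim⟩ := exists_subseq_convergesWeakly (x := b ∘ θ) fun n => hC (θ n)
    have hθφ : Tendsto (θ ∘ φ) atTop atTop :=
      (tendsto_atTop_mono (fun n => (hθ n).le) tendsto_id).comp hφ.tendsto_atTop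
    refine ⟨p, isWeakClusterPoint_of_tendsto hθφ hlim, fun s => ?_⟩
    refine norm_le_of_forall_sum_range_sq_le (hρ s) fun n => ?_
    have hslack : Tendsto (fun k => ρ s ^ 2 + (2 : ℝ)⁻¹ ^ φ k) atTop (𝓝 (ρ s ^ 2)) := by
      simpa using ((tendsto_pow_atTop_nhds_zero_of_lt_one (r := (2 : ℝ)⁻¹) (by norm_num)
        (by norm_num)).comp hφ.tendsto_atTop).const_add (ρ s ^ 2)
    refine le_of_tendsto_of_tendsto (hlim.tendsto_sum_sq_sub (c s) n) hslack ?_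
    filter_upwards [eventually_ge_atTop n] with k hk
    refine le_trans ?_ (hclose (φ k) s).le
    exact Finset.sum_le_sum_of_subset_of_nonneg
      (Finset.range_subset_range.2 (hk.trans (hφ.id_le k))) fun _ _ _ => sq_nonneg _

theorem isClosed_setOf_isWeakClusterPoint (hC : ∀ i, ‖b i‖ ≤ C) :
    IsClosed {p | IsWeakClusterPoint b p} := by
  refine isClosed_of_closure_subset fun p hp => ?_
  obtain ⟨q, hq, hqp⟩ : ∃ q, IsWeakClusterPoint b q ∧ ∀ _ : Unit, ‖q - p‖ ≤ 0 := by
    refine (exists_isWeakClusterPoint_forall_norm_sub_le_iff hC fun _ => le_rfl).2 fun n => ?_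
    obtain ⟨q, ⟨φ, hφ, hlim⟩, hpq⟩ := Metric.mem_closure_iff.1 hp
      (√((2 : ℝ)⁻¹ ^ n)) (by positivity)
    have hsum : ∑ j ∈ Finset.range n, (q j - p j) ^ 2 < (2 : ℝ)⁻¹ ^ n := by
      refine (sum_sq_le_norm_sq (q - p) _).trans_lt ?_
      rw [← dist_eq_norm, dist_comm]
      exact (Real.lt_sqrt dist_nonneg).1 hpq
    obtain ⟨k, hk, hnk⟩ := (((hlim.tendsto_sum_sq_sub p n).eventually_lt_const hsum).and
      (hφ.tendsto_atTop.eventually_gt_atTop n)).exists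
    exact ⟨φ k, hnk, fun _ => by simpa using hk⟩
  rwa [← sub_eq_zero.1 (norm_le_zero_iff.1 (hqp ()))]

theorem IsName.norm_sub_le {a : ℕ → List ℚ} (h : IsName a p) (n : ℕ) :
    ‖finiteSeqVec (a n) - p‖ ≤ (2 : ℝ)⁻¹ ^ n :=
  le_of_tendsto (tendsto_const_nhds.sub h.2).norm
    ((eventually_gt_atTop n).mono fun m hm => (h.1 n m hm).le)

end

/-! ### Primitive recursive families of rationals -/

section

open Encodable

theorem primrec_int_toNat : Primrec Int.toNat := by
  refine (Primrec.cond (Primrec.nat_bodd.comp Primrec.encode) (Primrec.const 0)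
    (Primrec.nat_div2.comp Primrec.encode)).of_eq ?_
  rintro (n | n)
  · change cond (Nat.bodd (2 * n)) 0 (Nat.div2 (2 * n)) = n
    simp
  · change cond (Nat.bodd (2 * n + 1)) 0 (Nat.div2 (2 * n + 1)) = 0
    simp

theorem primrec_int_natAbs : Primrec Int.natAbs := by
  refine (Primrec.nat_div2.comp (Primrec.succ.comp Primrec.encode)).of_eq ?_
  rintro (n | n)
  · change Nat.div2 (2 * n + 1) = n
    simp
  · change Nat.div2 (2 * (n + 1)) = n + 1
    simp

theorem coprime_iff_forall_lt_mod_ne_zero {m n : ℕ} :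
    m.Coprime n ↔ ∀ k < m + n + 1, m % k = 0 → n % k = 0 → k = 1 := by
  simp only [← Nat.dvd_iff_mod_eq_zero]
  refine ⟨fun h k _ hm hn => Nat.eq_one_of_dvd_coprimes h hm hn, fun h => ?_⟩
  refine h _ (Nat.lt_succ_of_le ?_) (Nat.gcd_dvd_left m n) (Nat.gcd_dvd_right m n)
  rcases m.eq_zero_or_pos with rfl | hm
  · simp
  · exact (Nat.gcd_le_left n hm).trans (Nat.le_add_right m n)

theorem primrecRel_coprime : PrimrecRel Nat.Coprime := by
  open Primrec in
  have hdvd : PrimrecRel fun (k : ℕ) (p : ℕ × ℕ) => ¬ p.1 % k = 0 ∨ ¬ p.2 % k = 0 ∨ k = 1 :=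
    (Primrec.eq.comp (nat_mod.comp (fst.comp snd) fst) (const 0)).not.or
      ((Primrec.eq.comp (nat_mod.comp (snd.comp snd) fst) (const 0)).not.or
        (Primrec.eq.comp fst (const 1)))
  refine (primrecPred_forall_lt hdvd (Primrec.succ.comp Primrec.nat_add)).of_eq fun p => ?_
  simp only [coprime_iff_forall_lt_mod_ne_zero, imp_iff_not_or, Nat.succ_eq_add_one]

/-- Rationals as reduced fractions. -/
def ratEquivReducedFraction : ℚ ≃ {p : ℤ × ℕ // p.2 ≠ 0 ∧ p.1.natAbs.Coprime p.2} where
  toFun q := ⟨(q.num, q.den), q.den_nz, q.reduced⟩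
  invFun p := ⟨p.1.1, p.1.2, p.2.1, p.2.2⟩

theorem primrecPred_den_ne_zero_and_coprime :
    PrimrecPred fun p : ℤ × ℕ => p.2 ≠ 0 ∧ p.1.natAbs.Coprime p.2 :=
  (Primrec.eq.comp Primrec.snd (Primrec.const 0)).not.and
    (primrecRel_coprime.comp (primrec_int_natAbs.comp Primrec.fst) Primrec.snd)

/-- The coding of rationals used by `finiteSeqCode`, by the pair of numerator and denominator. It
differs from the enumeration of `ℚ` behind Mathlib's `Encodable ℚ`. -/
abbrev primcodableRat : Primcodable ℚ :=
  letI := Primcodable.subtype primrecPred_den_ne_zero_and_coprime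
  Primcodable.ofEquiv _ ratEquivReducedFraction

attribute [local instance] primcodableRat

theorem encode_eq_finiteSeqCode (r : List ℚ) :
    (Primcodable.toEncodable (α := List ℚ)).encode r = finiteSeqCode r := by
  induction r with
  | nil => rfl
  | cons q r ih => exact congrArg (fun n => (Nat.pair (encode (q.num, q.den)) n).succ) ih

variable {α β : Type*} [Primcodable α] [Primcodable β]

theorem primrec_rat_iff {f : α → ℚ} : Primrec f ↔ Primrec fun a => ((f a).num, (f a).den) := by
  let := Primcodable.subtype primrecPred_den_ne_zero_and_coprime
  exact (Primrec.of_equiv_iff ratEquivReducedFraction).symm.trans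
    (Primrec.subtype_val_iff (hp := primrecPred_den_ne_zero_and_coprime)).symm

theorem primrec_pow : Primrec₂ ((· ^ ·) : ℕ → ℕ → ℕ) :=
  Primrec₂.unpaired'.1 Nat.Primrec.pow

theorem primrec_two_inv_pow : Primrec fun e : ℕ => (2 : ℚ)⁻¹ ^ e := by
  refine primrec_rat_iff.2 (((Primrec.const (1 : ℤ)).pair
    (primrec_pow.comp (Primrec.const 2) Primrec.id)).of_eq fun e => ?_)
  have h : (2 : ℚ)⁻¹ ^ e = ((2 ^ e : ℕ) : ℚ)⁻¹ := by rw [inv_pow, Nat.cast_pow, Nat.cast_ofNat]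
  rw [h, Rat.inv_natCast_num_of_pos (by positivity), Rat.inv_natCast_den_of_pos (by positivity), id]

/-- A family of rationals is a primitive recursive fraction if it is a quotient `(p - q) / r` of
primitive recursive functions. In contrast to primitive recursive functions to `ℚ`, the fraction
need not be reduced, so that closure under the arithmetic operations is immediate. -/
def IsPrimrecFraction (f : α → ℚ) : Prop :=
  ∃ p q r : α → ℕ, Primrec p ∧ Primrec q ∧ Primrec r ∧
    ∀ a, (r a : ℚ) ≠ 0 ∧ f a = ((p a : ℚ) - q a) / r a

namespace IsPrimrecFraction

variable {f g : α → ℚ}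

theorem of_primrec (hf : Primrec f) : IsPrimrecFraction f := by
  have hnum : Primrec fun a => (f a).num := Primrec.fst.comp (primrec_rat_iff.1 hf)
  have htoNat : Primrec fun a => (f a).num.toNat := primrec_int_toNat.comp hnum
  refine ⟨_, fun a => (f a).num.natAbs - (f a).num.toNat, _, htoNat,
    Primrec.nat_sub.comp (primrec_int_natAbs.comp hnum) htoNat,
    Primrec.snd.comp (primrec_rat_iff.1 hf), fun a => ⟨by simp, ?_⟩⟩
  have h : (f a).num = (f a).num.toNat - ((f a).num.natAbs - (f a).num.toNat : ℕ) := by omega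
  conv_lhs => rw [← Rat.num_div_den (f a), h]
  push_cast
  rfl

theorem comp {f : β → ℚ} (hf : IsPrimrecFraction f) {h : α → β} (hh : Primrec h) :
    IsPrimrecFraction fun a => f (h a) := by
  obtain ⟨p, q, r, hp, hq, hr, hf⟩ := hf
  exact ⟨_, _, _, hp.comp hh, hq.comp hh, hr.comp hh, fun a => hf (h a)⟩

theorem add (hf : IsPrimrecFraction f) (hg : IsPrimrecFraction g) :
    IsPrimrecFraction fun a => f a + g a := by
  obtain ⟨p, q, r, hp, hq, hr, hf⟩ := hf
  obtain ⟨p', q', r', hp', hq', hr', hg⟩ := hg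
  open Primrec in
  refine ⟨fun a => p a * r' a + p' a * r a, fun a => q a * r' a + q' a * r a,
    fun a => r a * r' a, nat_add.comp (nat_mul.comp hp hr') (nat_mul.comp hp' hr),
    nat_add.comp (nat_mul.comp hq hr') (nat_mul.comp hq' hr), nat_mul.comp hr hr', fun a => ?_⟩
  obtain ⟨hr0, hfa⟩ := hf a
  obtain ⟨hr'0, hga⟩ := hg a
  push_cast
  refine ⟨mul_ne_zero hr0 hr'0, ?_⟩
  rw [hfa, hga]
  field_simp
  ring

theorem neg (hf : IsPrimrecFraction f) : IsPrimrecFraction fun a => -f a := by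
  obtain ⟨p, q, r, hp, hq, hr, hf⟩ := hf
  exact ⟨q, p, r, hq, hp, hr, fun a => ⟨(hf a).1, by simp only [(hf a).2, ← neg_div, neg_sub]⟩⟩

theorem sub (hf : IsPrimrecFraction f) (hg : IsPrimrecFraction g) :
    IsPrimrecFraction fun a => f a - g a := by
  simpa only [sub_eq_add_neg] using hf.add hg.neg

theorem sq (hf : IsPrimrecFraction f) : IsPrimrecFraction fun a => f a ^ 2 := by
  obtain ⟨p, q, r, hp, hq, hr, hf⟩ := hf
  open Primrec in
  refine ⟨fun a => p a * p a + q a * q a, fun a => 2 * (p a * q a), fun a => r a * r a,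
    nat_add.comp (nat_mul.comp hp hp) (nat_mul.comp hq hq),
    nat_mul.comp (const 2) (nat_mul.comp hp hq), nat_mul.comp hr hr, fun a => ?_⟩
  obtain ⟨hr0, hfa⟩ := hf a
  push_cast
  refine ⟨mul_ne_zero hr0 hr0, ?_⟩
  rw [hfa]
  field_simp
  ring

theorem sum_range {f : α → ℕ → ℚ} (hf : IsPrimrecFraction fun p : α × ℕ => f p.1 p.2)
    {n : α → ℕ} (hn : Primrec n) :
    IsPrimrecFraction fun a => ∑ j ∈ Finset.range (n a), f a j := by
  obtain ⟨p, q, r, hp, hq, hr, hf⟩ := hf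
  let addTerm (a : α) (j : ℕ) (s : ℕ × ℕ × ℕ) : ℕ × ℕ × ℕ :=
    (s.1 * r (a, j) + p (a, j) * s.2.2, s.2.1 * r (a, j) + q (a, j) * s.2.2, s.2.2 * r (a, j))
  let partialSum (a : α) (m : ℕ) : ℕ × ℕ × ℕ := m.rec (0, 0, 1) (addTerm a)
  open Primrec in
  have haddTerm : Primrec₂ fun a (x : ℕ × ℕ × ℕ × ℕ) => addTerm a x.1 x.2 := by
    have hs : Primrec fun x : α × ℕ × ℕ × ℕ × ℕ => x.2.2 := snd.comp snd
    have hj : Primrec fun x : α × ℕ × ℕ × ℕ × ℕ => (x.1, x.2.1) := fst.pair (fst.comp snd)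
    have hden : Primrec fun x : α × ℕ × ℕ × ℕ × ℕ => x.2.2.2.2 := (snd.comp snd).comp hs
    exact (nat_add.comp (nat_mul.comp (fst.comp hs) (hr.comp hj))
      (nat_mul.comp (hp.comp hj) hden)).pair
      ((nat_add.comp (nat_mul.comp (fst.comp (snd.comp hs)) (hr.comp hj))
        (nat_mul.comp (hq.comp hj) hden)).pair (nat_mul.comp hden (hr.comp hj)))
  have hpartialSum : Primrec fun a => partialSum a (n a) :=
    Primrec.nat_rec' hn (Primrec.const (0, 0, 1)) haddTerm
  have partialSum_spec (a : α) (m : ℕ) : ((partialSum a m).2.2 : ℚ) ≠ 0 ∧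
      ∑ j ∈ Finset.range m, f a j =
        (((partialSum a m).1 : ℚ) - (partialSum a m).2.1) / (partialSum a m).2.2 := by
    induction m with
    | zero => simp [partialSum]
    | succ m ih =>
      have hr0 := (hf (a, m)).1
      have hfm : f a m = _ := (hf (a, m)).2
      have hsucc : partialSum a (m + 1) = addTerm a m (partialSum a m) := rfl
      rw [Finset.sum_range_succ, ih.2, hfm, hsucc]
      have hs0 := ih.1
      generalize partialSum a m = s at hs0 ⊢
      simp only [addTerm]
      push_cast
      refine ⟨mul_ne_zero hs0 hr0, ?_⟩
      field_simp
      ring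
  exact ⟨_, _, _, Primrec.fst.comp hpartialSum, (Primrec.fst.comp Primrec.snd).comp hpartialSum,
    (Primrec.snd.comp Primrec.snd).comp hpartialSum, fun a => partialSum_spec a (n a)⟩

theorem lt (hf : IsPrimrecFraction f) (hg : IsPrimrecFraction g) :
    PrimrecPred fun a => f a < g a := by
  obtain ⟨p, q, r, hp, hq, hr, hf⟩ := hf
  obtain ⟨p', q', r', hp', hq', hr', hg⟩ := hg
  open Primrec in
  refine (nat_lt.comp (nat_add.comp (nat_mul.comp hp hr') (nat_mul.comp hq' hr))
    (nat_add.comp (nat_mul.comp hp' hr) (nat_mul.comp hq hr'))).of_eq fun a => ?_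
  have hr0 : (0 : ℚ) < r a := (Nat.cast_nonneg _).lt_of_ne' (hf a).1
  have hr'0 : (0 : ℚ) < r' a := (Nat.cast_nonneg _).lt_of_ne' (hg a).1
  rw [(hf a).2, (hg a).2, div_lt_div_iff₀ hr0 hr'0, sub_mul, sub_mul, sub_lt_iff_lt_add,
    sub_add_eq_add_sub, lt_sub_iff_add_lt]
  exact_mod_cast Iff.rfl

end IsPrimrecFraction

end

/-! ### Coding the double jump into weak cluster points -/

section

open Encodable

variable {R : ℕ → ℕ → ℕ → Prop} {e v : ℕ}

theorem eventually_forall_lt_iff_forall (P : ℕ → Prop) :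
    ∀ᶠ i in atTop, ((∀ s < i, P s) ↔ ∀ s, P s) := by
  by_cases h : ∀ s, P s
  · exact .of_forall fun i => ⟨fun _ => h, fun _ s _ => h s⟩
  · obtain ⟨s, hs⟩ := not_forall.1 h
    filter_upwards [eventually_gt_atTop s] with i hi
    exact ⟨fun hP => absurd (hP s hi) hs, fun hP s _ => hP s⟩

theorem isLeast_iff_mem_and_forall_lt_notMem {S : Set ℕ} :
    IsLeast S v ↔ v ∈ S ∧ ∀ u < v, u ∉ S :=
  and_congr_right' (forall_congr' fun _ => by rw [← not_lt, imp_not_comm])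

theorem exists_isLeast_iff_nonempty {S : Set ℕ} : (∃ v, IsLeast S v) ↔ S.Nonempty :=
  ⟨fun ⟨v, hv⟩ => ⟨v, hv.1⟩, fun h => ⟨sInf S, Nat.sInf_mem h, fun _ => Nat.sInf_le⟩⟩

theorem eventually_isLeast_forall_lt_iff (P : ℕ → ℕ → Prop) (v : ℕ) :
    ∀ᶠ i in atTop, (IsLeast {v | ∀ s < i, P v s} v ↔ IsLeast {v | ∀ s, P v s} v) := by
  have h : ∀ᶠ i in atTop, ∀ u ∈ Set.Iio v, ((∀ s < i, P u s) ↔ ∀ s, P u s) :=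
    (eventually_all_finite (Set.finite_Iio v)).2 fun u _ => eventually_forall_lt_iff_forall (P u)
  filter_upwards [h, eventually_forall_lt_iff_forall (P v)] with i hi hv
  simp only [isLeast_iff_mem_and_forall_lt_notMem]
  exact and_congr hv (forall₂_congr fun u hu => not_congr (hi u hu))

theorem primrecPred_isLeast_forall_lt (hR : PrimrecPred fun p : (ℕ × ℕ) × ℕ => R p.1.1 p.1.2 p.2) :
    PrimrecPred fun p : (ℕ × ℕ) × ℕ => IsLeast {v | ∀ s < p.2, R p.1.1 v s} p.1.2 := by
  open Primrec in
  have hforall : PrimrecPred fun p : (ℕ × ℕ) × ℕ => ∀ s < p.2, R p.1.1 p.1.2 s :=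
    primrecPred_forall_lt (R := fun s (p : (ℕ × ℕ) × ℕ) => R p.1.1 p.1.2 s)
      (hR.comp ((fst.comp snd).pair fst)) snd
  have hleast : PrimrecPred fun p : (ℕ × ℕ) × ℕ => ∀ u < p.1.2, ¬ ∀ s < p.2, R p.1.1 u s :=
    primrecPred_forall_lt (R := fun u (p : (ℕ × ℕ) × ℕ) => ¬ ∀ s < p.2, R p.1.1 u s)
      (hforall.comp (((fst.comp (fst.comp snd)).pair fst).pair (snd.comp snd))).not (snd.comp fst)
  exact (hforall.and hleast).of_eq fun p => by
    rw [isLeast_iff_mem_and_forall_lt_notMem]; rfl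

open Classical in
/-- The coordinate `j = (e, v)` of the `i`-th vector of the coding sequence. It is nonzero if `v`
is the least witness of `∃ v, ∀ s, R e v s`, as far as the numbers `s < i` can tell. -/
noncomputable def codingCoord (R : ℕ → ℕ → ℕ → Prop) (i j : ℕ) : ℚ :=
  if IsLeast {v | ∀ s < i, R j.unpair.1 v s} j.unpair.2 then 2⁻¹ ^ j.unpair.1 else 0

/-- The bounded sequence of finitely supported vectors whose weak cluster points compute the `Σ₂`
set `{e | ∃ v, ∀ s, R e v s}`. -/
noncomputable def codingSeq (R : ℕ → ℕ → ℕ → Prop) (i : ℕ) : List ℚ :=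
  (List.range i).map (codingCoord R i)

open Classical in
theorem finiteSeqVec_codingSeq_apply (R : ℕ → ℕ → ℕ → Prop) (i j : ℕ) :
    finiteSeqVec (codingSeq R i) j =
      if j < i ∧ IsLeast {v | ∀ s < i, R j.unpair.1 v s} j.unpair.2 then 2⁻¹ ^ j.unpair.1
        else 0 := by
  rw [finiteSeqVec_apply, codingSeq]
  by_cases hj : j < i
  · simp [List.getD, hj, codingCoord, apply_ite (Rat.cast : ℚ → ℝ)]
  · simp [List.getD, hj]

open Classical in
theorem tendsto_finiteSeqVec_codingSeq (R : ℕ → ℕ → ℕ → Prop) (j : ℕ) :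
    Tendsto (fun i => finiteSeqVec (codingSeq R i) j) atTop
      (𝓝 (if IsLeast {v | ∀ s, R j.unpair.1 v s} j.unpair.2 then 2⁻¹ ^ j.unpair.1 else 0)) := by
  refine tendsto_const_nhds.congr' ?_
  filter_upwards [eventually_gt_atTop j,
    eventually_isLeast_forall_lt_iff (R j.unpair.1) j.unpair.2] with i hi h
  simp only [finiteSeqVec_codingSeq_apply, hi, h, true_and]

theorem sum_pow_le_of_injOn {ι : Type*} {s : Finset ι} {f : ι → ℕ} (hf : Set.InjOn f s) {r : ℝ}
    (h₀ : 0 ≤ r) (h₁ : r < 1) : ∑ j ∈ s, r ^ f j ≤ (1 - r)⁻¹ := by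
  classical
  rw [← Finset.sum_image hf, ← tsum_geometric_of_lt_one h₀ h₁]
  exact (summable_geometric_of_lt_one h₀ h₁).sum_le_tsum _ fun e _ => pow_nonneg h₀ e

/- For each `e` there is at most one least witness, so the coordinates are dominated by a geometric
series. -/
theorem norm_finiteSeqVec_codingSeq_le (R : ℕ → ℕ → ℕ → Prop) (i : ℕ) :
    ‖finiteSeqVec (codingSeq R i)‖ ≤ 2 := by
  classical
  refine norm_le_of_forall_sum_range_sq_le zero_le_two fun n => ?_
  let support := (Finset.range n).filter fun j =>
    j < i ∧ IsLeast {v | ∀ s < i, R j.unpair.1 v s} j.unpair.2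
  have hinj : Set.InjOn (fun j : ℕ => j.unpair.1) support := by
    intro j hj k hk (hjk : j.unpair.1 = k.unpair.1)
    have hj := (Finset.mem_filter.1 hj).2.2
    have hk := (Finset.mem_filter.1 hk).2.2
    rw [hjk] at hj
    rw [← Nat.pair_unpair j, ← Nat.pair_unpair k, hjk, hj.unique hk]
  calc ∑ j ∈ Finset.range n, finiteSeqVec (codingSeq R i) j ^ 2
      = ∑ j ∈ support, ((2 : ℝ)⁻¹ ^ 2) ^ j.unpair.1 := by
        rw [Finset.sum_filter]
        refine Finset.sum_congr rfl fun j _ => ?_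
        rw [finiteSeqVec_codingSeq_apply]
        split_ifs
        · rw [pow_right_comm]
        · rw [zero_pow two_ne_zero]
    _ ≤ (1 - (2 : ℝ)⁻¹ ^ 2)⁻¹ := sum_pow_le_of_injOn hinj (by norm_num) (by norm_num)
    _ ≤ 2 ^ 2 := by norm_num

theorem isName_const (r : List ℚ) : IsName (fun _ => r) (finiteSeqVec r) :=
  ⟨fun n m _ => by rw [sub_self, norm_zero]; positivity, tendsto_const_nhds⟩

attribute [local instance] primcodableRat

theorem primrec_codingSeq (hR : PrimrecPred fun p : (ℕ × ℕ) × ℕ => R p.1.1 p.1.2 p.2) :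
    Primrec (codingSeq R) := by
  classical
  open Primrec in
  have hj : Primrec fun p : ℕ × ℕ => p.2.unpair := Primrec.unpair.comp snd
  exact list_map list_range (ite ((primrecPred_isLeast_forall_lt hR).comp (hj.pair fst))
    (primrec_two_inv_pow.comp (fst.comp hj)) (const 0))

theorem isComputableSeq_codingSeq (hR : PrimrecPred fun p : (ℕ × ℕ) × ℕ => R p.1.1 p.1.2 p.2) :
    IsComputableSeq fun i => finiteSeqVec (codingSeq R i) := by
  refine ⟨fun i _ => codingSeq R i, fun i => isName_const _, ?_⟩
  simp only [← encode_eq_finiteSeqCode]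
  exact (Primrec.encode.comp ((primrec_codingSeq hR).comp .fst)).to_comp

/-- Some coordinate `(e, v)` of the finite sequence `r` is larger than half of `2⁻ᵉ`, the value by
which `codingSeq` marks a least witness `v` for `e`. -/
def HasLargeCoord (e : ℕ) (r : List ℚ) : Prop :=
  ∃ v, 2⁻¹ ^ (e + 1) < r.getD (Nat.pair e v) 0

theorem hasLargeCoord_iff_exists_lt_length {r : List ℚ} :
    HasLargeCoord e r ↔ ∃ j < r.length, j.unpair.1 = e ∧ 2⁻¹ ^ (e + 1) < r.getD j 0 := by
  constructor
  · rintro ⟨v, hv⟩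
    refine ⟨Nat.pair e v, not_le.1 fun hle => ?_, by rw [Nat.unpair_pair], hv⟩
    rw [List.getD_eq_default _ _ hle] at hv
    exact hv.not_ge (by positivity)
  · rintro ⟨j, -, rfl, hj⟩
    exact ⟨j.unpair.2, by rwa [Nat.pair_unpair]⟩

theorem primrecRel_hasLargeCoord : PrimrecRel HasLargeCoord := by
  simp only [PrimrecRel, hasLargeCoord_iff_exists_lt_length]
  open Primrec in
  have hlt : PrimrecPred fun p : ℕ × ℕ × List ℚ => (2 : ℚ)⁻¹ ^ (p.2.1 + 1) < p.2.2.getD p.1 0 :=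
    (IsPrimrecFraction.of_primrec (primrec_two_inv_pow.comp (succ.comp (fst.comp snd)))).lt
      (.of_primrec ((list_getD 0).comp (snd.comp snd) fst))
  exact primrecPred_exists_lt (R := fun j (p : ℕ × List ℚ) =>
    j.unpair.1 = p.1 ∧ 2⁻¹ ^ (p.1 + 1) < p.2.getD j 0)
    ((Primrec.eq.comp (fst.comp (unpair.comp fst)) (fst.comp snd)).and hlt) (list_length.comp snd)

theorem lt_iff_of_abs_sub_le {ε x y : ℝ} {P : Prop} [Decidable P] (hε : 0 < ε)
    (hy : y = if P then ε else 0) (h : |x - y| ≤ ε / 4) : ε / 2 < x ↔ P := by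
  rw [abs_le] at h
  split_ifs at hy with hP
  · exact iff_of_true (by linarith) hP
  · exact iff_of_false (by linarith) hP

theorem hasLargeCoord_iff_of_isWeakClusterPoint {p : Ell2}
    (hp : IsWeakClusterPoint (fun i => finiteSeqVec (codingSeq R i)) p) {a : ℕ → List ℚ}
    (ha : IsName a p) (e : ℕ) : HasLargeCoord e (a (e + 2)) ↔ ∃ v, ∀ s, R e v s := by
  classical
  obtain ⟨φ, hφ, hlim⟩ := hp
  refine Iff.trans (exists_congr fun v => ?_)
    (exists_isLeast_iff_nonempty (S := {v | ∀ s, R e v s}))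
  have hcoord := tendsto_nhds_unique (hlim.tendsto_apply (Nat.pair e v))
    ((tendsto_finiteSeqVec_codingSeq R (Nat.pair e v)).comp hφ.tendsto_atTop)
  rw [Nat.unpair_pair] at hcoord
  have hdist : |finiteSeqVec (a (e + 2)) (Nat.pair e v) - p (Nat.pair e v)| ≤ 2⁻¹ ^ (e + 2) :=
    (lp.norm_apply_le_norm two_ne_zero (finiteSeqVec (a (e + 2)) - p) (Nat.pair e v)).trans
      (ha.norm_sub_le _)
  rw [← lt_iff_of_abs_sub_le (by positivity) hcoord (hdist.trans_eq (by ring)),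
    finiteSeqVec_apply, ← Rat.cast_lt (K := ℝ)]
  push_cast
  rw [pow_succ, div_eq_mul_inv]

theorem degreeOf_charFun_le_of_isWeakClusterPoint_codingSeq {d : TuringDegree} {p : Ell2}
    (hp : IsWeakClusterPoint (fun i => finiteSeqVec (codingSeq R i)) p)
    (hd : DegreeComputes d p) : degreeOf (charFun {e | ∃ v, ∀ s, R e v s}) ≤ d := by
  obtain ⟨a, ha, had⟩ := hd
  simp only [← encode_eq_finiteSeqCode] at had
  simp only [← hasLargeCoord_iff_of_isWeakClusterPoint hp ha]
  exact degreeOf_charFun_setOf_rel_apply_le primrecRel_hasLargeCoord.computablePred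
    (degreeOf_comp_le had (degreeOf_le_of_computable (Primrec.nat_add.comp .id (.const 2)).to_comp))

theorem zeroDoubleJump_le_of_forall_degreeComputes {d : TuringDegree}
    (h : ∀ x : ℕ → Ell2, IsComputableSeq x → (∃ C : ℝ, ∀ i, ‖x i‖ ≤ C) →
      ∃ p : Ell2, IsWeakClusterPoint x p ∧ DegreeComputes d p) : zeroDoubleJump ≤ d := by
  obtain ⟨R, hR, hmem⟩ := exists_primrecPred_mem_doubleJump_iff_exists_forall
  obtain ⟨p, hp, hd⟩ := h _ (isComputableSeq_codingSeq hR) ⟨2, norm_finiteSeqVec_codingSeq_le R⟩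
  rw [zeroDoubleJump, Set.ext hmem]
  exact degreeOf_charFun_le_of_isWeakClusterPoint_codingSeq hp hd

end

/-! ### Searching for a weak cluster point -/

section

variable {E α : Type*} [PseudoMetricSpace E] {K : Set E} {c : ℕ → E}

/-- The closed balls of radii `2⁻², 2⁻³, …` around the members of `L` have a common point in `K`.
The radii make the centers of an infinite sequence of such balls satisfy the condition of
`IsName`. -/
def BallsMeet (K : Set E) (L : List E) : Prop :=
  ∃ p ∈ K, ∀ s : Fin L.length, dist p (L.get s) ≤ 2⁻¹ ^ (s + 2 : ℕ)

theorem ballsMeet_nil_iff : BallsMeet K [] ↔ K.Nonempty :=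
  ⟨fun ⟨p, hp, _⟩ => ⟨p, hp⟩, fun ⟨p, hp⟩ => ⟨p, hp, fun s => s.elim0⟩⟩

theorem BallsMeet.exists_concat {v : α → E} (hv : DenseRange v) {L : List α}
    (h : BallsMeet K (L.map v)) : ∃ a, BallsMeet K ((L ++ [a]).map v) := by
  obtain ⟨p, hp, hdist⟩ := h
  obtain ⟨a, ha⟩ := hv.exists_dist_lt p (show (0 : ℝ) < 2⁻¹ ^ (L.length + 2) by positivity)
  refine ⟨a, p, hp, fun ⟨s, hs⟩ => ?_⟩
  simp only [List.map_append, List.map_singleton, List.get_eq_getElem, List.getElem_append,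
    List.length_map]
  split_ifs with hsL
  · exact hdist ⟨s, by simpa using hsL⟩
  · have hs : s = L.length := by simp at hs; omega
    simpa [hs] using ha.le

theorem ballsMeet_map_range_iff {m : ℕ} :
    BallsMeet K ((List.range m).map c) ↔ ∃ p ∈ K, ∀ s < m, dist p (c s) ≤ 2⁻¹ ^ (s + 2) := by
  simp [BallsMeet, Fin.forall_iff]

theorem dist_lt_of_forall_ballsMeet (h : ∀ m, BallsMeet K ((List.range m).map c)) {s t : ℕ}
    (hst : s < t) : dist (c s) (c t) < 2⁻¹ ^ s := by
  obtain ⟨p, -, hp⟩ := ballsMeet_map_range_iff.1 (h (t + 1))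
  have hradius : (2 : ℝ)⁻¹ ^ (t + 2) ≤ 2⁻¹ ^ (s + 2) :=
    pow_le_pow_of_le_one (by norm_num) (by norm_num) (by lia)
  calc dist (c s) (c t) ≤ dist p (c s) + dist p (c t) := dist_triangle_left _ _ _
    _ ≤ 2⁻¹ ^ (s + 2) + 2⁻¹ ^ (s + 2) :=
      add_le_add (hp s (by lia)) ((hp t (by lia)).trans hradius)
    _ = 2⁻¹ ^ s / 2 := by ring
    _ < 2⁻¹ ^ s := half_lt_self (by positivity)

theorem exists_mem_tendsto_of_forall_ballsMeet [CompleteSpace E] (hK : IsClosed K)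
    (h : ∀ m, BallsMeet K ((List.range m).map c)) : ∃ p ∈ K, Tendsto c atTop (𝓝 p) := by
  obtain ⟨p, hp⟩ := cauchySeq_tendsto_of_complete <|
    cauchySeq_of_le_geometric (2 : ℝ)⁻¹ 1 (by norm_num) fun s => by
      simpa using (dist_lt_of_forall_ballsMeet h s.lt_succ_self).le
  choose q hqK hq using fun m => ballsMeet_map_range_iff.1 (h (m + 1))
  have hdist : Tendsto (fun m => dist (c m) (q m)) atTop (𝓝 0) := by
    refine squeeze_zero (fun _ => dist_nonneg)
      (fun m => (dist_comm _ _).trans_le (hq m m m.lt_succ_self)) ?_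
    exact (tendsto_pow_atTop_nhds_zero_of_lt_one (by norm_num) (by norm_num)).comp
      (tendsto_add_atTop_nat 2)
  exact ⟨p, hK.mem_of_tendsto (hp.congr_dist hdist) (.of_forall hqK), hp⟩

end

section

attribute [local instance] primcodableRat

variable {q : ℕ → List ℚ} {C : ℝ}

theorem ballsMeet_isWeakClusterPoint_iff (hC : ∀ i, ‖finiteSeqVec (q i)‖ ≤ C)
    {L : List (List ℚ)} :
    BallsMeet {p | IsWeakClusterPoint (fun i => finiteSeqVec (q i)) p} (L.map finiteSeqVec) ↔
      ∀ n, ∃ i, n < i ∧ ∀ s < L.length, ∑ j ∈ Finset.range n,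
        ((q i).getD j 0 - (L.getD s []).getD j 0) ^ 2 < (2⁻¹ ^ (s + 2)) ^ 2 + 2⁻¹ ^ n := by
  have hcast (i n s : ℕ) : ∑ j ∈ Finset.range n, (finiteSeqVec (q i) j -
        finiteSeqVec (L.getD s []) j) ^ 2 < (2⁻¹ ^ (s + 2)) ^ 2 + 2⁻¹ ^ n ↔
      ∑ j ∈ Finset.range n, ((q i).getD j 0 - (L.getD s []).getD j 0) ^ 2 <
        (2⁻¹ ^ (s + 2)) ^ 2 + 2⁻¹ ^ n := by
    rw [← Rat.cast_lt (K := ℝ)]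
    push_cast
    rfl
  have h := exists_isWeakClusterPoint_forall_norm_sub_le_iff hC
    (c := fun s : Fin L.length => finiteSeqVec (L.getD s [])) (ρ := fun s => 2⁻¹ ^ (s + 2 : ℕ))
    fun s => by positivity
  simp only [hcast, Fin.forall_iff] at h
  rw [← h]
  simp only [BallsMeet, Fin.forall_iff, dist_eq_norm, List.get_eq_getElem, List.getElem_map,
    List.length_map, Set.mem_ofPred_eq]
  refine exists_congr fun p => and_congr_right' (forall₂_congr fun s hs => ?_)
  rw [List.getD_eq_getElem _ _ hs]

theorem primrecPred_sum_sq_sub_lt :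
    PrimrecPred fun p : (List (List ℚ) × ℕ) × List ℚ => ∀ s < p.1.1.length,
      ∑ j ∈ Finset.range p.1.2, (p.2.getD j 0 - (p.1.1.getD s []).getD j 0) ^ 2 <
        (2⁻¹ ^ (s + 2)) ^ 2 + 2⁻¹ ^ p.1.2 := by
  open Primrec in
  have hn : Primrec fun p : ℕ × (List (List ℚ) × ℕ) × List ℚ => p.2.1.2 :=
    snd.comp (fst.comp snd)
  have hcenter : Primrec fun p : ℕ × (List (List ℚ) × ℕ) × List ℚ => p.2.1.1.getD p.1 [] :=
    (list_getD []).comp (fst.comp (fst.comp snd)) fst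
  have hcoord : IsPrimrecFraction fun p : (ℕ × (List (List ℚ) × ℕ) × List ℚ) × ℕ =>
      p.1.2.2.getD p.2 0 := .of_primrec ((list_getD 0).comp (snd.comp (snd.comp fst)) snd)
  have hcenterCoord : IsPrimrecFraction fun p : (ℕ × (List (List ℚ) × ℕ) × List ℚ) × ℕ =>
      (p.1.2.1.1.getD p.1.1 []).getD p.2 0 :=
    .of_primrec ((list_getD 0).comp (hcenter.comp fst) snd)
  have hsum := IsPrimrecFraction.sum_range (f := fun p j =>
    (p.2.2.getD j 0 - (p.2.1.1.getD p.1 []).getD j 0) ^ 2) (hcoord.sub hcenterCoord).sq hn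
  have hbound := ((IsPrimrecFraction.of_primrec primrec_two_inv_pow).comp
    (Primrec.nat_add.comp fst (const 2))).sq.add (.of_primrec (primrec_two_inv_pow.comp hn))
  exact primrecPred_forall_lt (hsum.lt hbound) (list_length.comp (fst.comp fst))

theorem computablePred_sum_sq_sub_lt (hq : Computable q) :
    ComputablePred fun p : (List (List ℚ) × ℕ) × ℕ => p.1.2 < p.2 ∧ ∀ s < p.1.1.length,
      ∑ j ∈ Finset.range p.1.2, ((q p.2).getD j 0 - (p.1.1.getD s []).getD j 0) ^ 2 <
        (2⁻¹ ^ (s + 2)) ^ 2 + 2⁻¹ ^ p.1.2 := by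
  have hlt : PrimrecPred fun p : ((List (List ℚ) × ℕ) × ℕ) × List ℚ => p.1.1.2 < p.1.2 :=
    Primrec.nat_lt.comp (.comp .snd (.comp .fst .fst)) (.comp .snd .fst)
  have hsum := primrecPred_sum_sq_sub_lt.comp
    (f := fun p : ((List (List ℚ) × ℕ) × ℕ) × List ℚ => (p.1.1, p.2))
    (.pair (.comp .fst .fst) .snd)
  exact computablePred_comp (hlt.and hsum).computablePred
    (f := fun p : (List (List ℚ) × ℕ) × ℕ => (p, q p.2)) (Computable.id.pair (hq.comp .snd))

theorem degreeOf_charFun_ballsMeet_le (hq : Computable q) (hC : ∀ i, ‖finiteSeqVec (q i)‖ ≤ C) :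
    degreeOf (charFun ((Primcodable.toEncodable (α := List (List ℚ))).encode ''
      {L | BallsMeet {p | IsWeakClusterPoint (fun i => finiteSeqVec (q i)) p}
        (L.map finiteSeqVec)})) ≤ zeroDoubleJump := by
  simp only [ballsMeet_isWeakClusterPoint_iff hC]
  exact degreeOf_charFun_image_encode_forall_exists_le (computablePred_sum_sq_sub_lt hq)

theorem exists_isWeakClusterPoint_degreeComputes_of_computable (hq : Computable q)
    (hC : ∀ i, ‖finiteSeqVec (q i)‖ ≤ C) :
    ∃ p, IsWeakClusterPoint (fun i => finiteSeqVec (q i)) p ∧ DegreeComputes zeroDoubleJump p := by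
  obtain ⟨p, φ, hφ, hlim⟩ := exists_subseq_convergesWeakly hC
  obtain ⟨c, hdeg, hc⟩ := exists_sequence_forall_map_range_mem (degreeOf_charFun_ballsMeet_le hq hC)
    (ballsMeet_nil_iff.2 ⟨p, φ, hφ, hlim⟩) fun L hL => hL.exists_concat denseRange_finiteSeqVec
  simp only [Set.mem_ofPred_eq, List.map_map] at hc
  obtain ⟨p, hp, hcp⟩ :=
    exists_mem_tendsto_of_forall_ballsMeet (isClosed_setOf_isWeakClusterPoint hC) hc
  simp only [encode_eq_finiteSeqCode] at hdeg
  refine ⟨p, hp, c, ⟨fun s t hst => ?_, hcp⟩, hdeg⟩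
  exact (dist_eq_norm _ _).symm.trans_lt (dist_lt_of_forall_ballsMeet hc hst)

theorem exists_isWeakClusterPoint_degreeComputes_zeroDoubleJump {x : ℕ → Ell2}
    (hx : IsComputableSeq x) (hC : ∀ i, ‖x i‖ ≤ C) :
    ∃ p, IsWeakClusterPoint x p ∧ DegreeComputes zeroDoubleJump p := by
  obtain ⟨a, ha, ha_comp⟩ := hx
  have hdist (i : ℕ) : ‖x i - finiteSeqVec (a i i)‖ ≤ 2⁻¹ ^ i :=
    (norm_sub_rev _ _).trans_le ((ha i).norm_sub_le i)
  have hbound (i : ℕ) : ‖finiteSeqVec (a i i)‖ ≤ C + 1 := by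
    have htriangle := norm_le_norm_add_norm_sub (x i) (finiteSeqVec (a i i))
    have hpow : (2 : ℝ)⁻¹ ^ i ≤ 1 := pow_le_one₀ (by norm_num) (by norm_num)
    linarith only [htriangle, hpow, hC i, hdist i]
  simp only [← encode_eq_finiteSeqCode] at ha_comp
  have hdiag : Computable fun i => a i i :=
    (Computable.encode_iff.1 ha_comp).comp (Computable.id.pair .id)
  obtain ⟨p, hp, hdeg⟩ := exists_isWeakClusterPoint_degreeComputes_of_computable hdiag hbound
  exact ⟨p, hp.of_tendsto_sub (squeeze_zero_norm hdist
    (tendsto_pow_atTop_nhds_zero_of_lt_one (by norm_num) (by norm_num))), hdeg⟩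

end

theorem mainTheorem3 (d : TuringDegree) :
    zeroDoubleJump ≤ d ↔
      ∀ x : ℕ → Ell2, IsComputableSeq x → (∃ C : ℝ, ∀ i, ‖x i‖ ≤ C) →
        ∃ p : Ell2, IsWeakClusterPoint x p ∧ DegreeComputes d p := by
  refine ⟨fun h x hx ⟨C, hC⟩ => ?_, zeroDoubleJump_le_of_forall_degreeComputes⟩
  obtain ⟨p, hp, a, ha, hdeg⟩ := exists_isWeakClusterPoint_degreeComputes_zeroDoubleJump hx hC
  exact ⟨p, hp, a, ha, hdeg.trans h⟩
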